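/- **Theorem 3.4.** Let $(M_1,J,g_1)$ be a non-empty Kähler manifold of real dimension $2n$, $n\ge 1$ (an almost Hermitian manifold with $g_1$ Riemannian and $\tilde\nabla J=0$ for the Levi-Civita connection $\tilde\nabla$ of $g_1$). Suppose that its fundamental 2-form $\Phi_1(X_1,Y_1)=g_1(X_1,JY_1)$ is exact, and let $\omega$ be a smooth 1-form on $M_1$ with $d\omega=\Phi_1$, where $2\,d\omega(X_1,Y_1)=X_1\omega(Y_1)-Y_1\omega(X_1)-\omega([X_1,Y_1])$. Let $\beta:I\to E^m$ be an open curve, that is, a smooth regular curve without self-intersections on a non-empty open interval $I$; give $\beta(I)$ the manifold structure for which $\beta:I\to\beta(I)$ is a diffeomorphism, and let $T$ be the unit tangent vector field of $\beta$. Let $\alpha$ be a real constant. On $M=M_1\times\beta(I)$, whose tangent vectors are written $(X_1,hT)$ with $h\in\mathbb R$, put $$\bar\phi(X_1,hT)=(JX_1,-\alpha\,\omega(JX_1)\,T),\qquad \bar\xi=(0,T),\qquad \bar\eta(X_1,hT)=\alpha\,\omega(X_1)+h,$$ $$g\big((X_1,h_1T),(Y_1,h_2T)\big)=g_1(X_1,Y_1)+\bar\eta(X_1,h_1T)\,\bar\eta(Y_1,h_2T).$$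 Then $(\bar\phi,\bar\xi,\bar\eta,g)$ is an almost contact metric structure on $M$: the tensor fields $\bar\phi,\bar\xi,\bar\eta$ are smooth, $g$ is a Riemannian metric, $\bar\phi^2X=-X+\bar\eta(X)\bar\xi$, $\bar\eta(\bar\xi)=1$ and $g(\bar\phi X,\bar\phi Y)=g(X,Y)-\bar\eta(X)\bar\eta(Y)$. The Levi-Civita connection $\nabla$ of $g$ satisfies $$(\nabla_X\bar\phi)Y=\alpha\big(g(X,Y)\bar\xi-\bar\eta(Y)X\big)\qquad\text{for all smooth vector fields }X,Y\text{ on }M.$$ Hence, if $\alpha\ne0$, the structure is $\alpha$-Sasakian (which means: almost contact metric, with this identity for the non-zero constant $\alpha$). It is Sasakian (almost contact metric, with $(\nabla_X\bar\phi)Y=g(X,Y)\bar\xi-\bar\eta(Y)X$ for all smooth $X,Y$) if and only if $\alpha=1$. -/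

import Mathlib

open Bundle Manifold
open scoped ContDiff Topology

noncomputable section

section Geometry

variable {E : Type*} [NormedAddCommGroup E] [NormedSpace ℝ E]
  {H : Type*} [TopologicalSpace H] {I : ModelWithCorners ℝ E H}
  {M : Type*} [TopologicalSpace M] [ChartedSpace H M]

/-- `X ∈ χ(M)`: the vector field `X` is smooth, as a map into the tangent bundle. -/
def IsSmoothField [IsManifold I 1 M] (X : Π x : M, TangentSpace I x) : Prop :=
  ContMDiff I I.tangent ∞ (fun x ↦ (⟨x, X x⟩ : TangentBundle I M))

/-- A field of linear forms on the tangent spaces is a smooth 1-form. -/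
def IsSmoothOneForm [IsManifold I 1 M] (ω₁ : Π x : M, TangentSpace I x →L[ℝ] ℝ) : Prop :=
  ContMDiff I (I.prod 𝓘(ℝ, E →L[ℝ] ℝ)) ∞ (fun x ↦ TotalSpace.mk' (E →L[ℝ] ℝ) x (ω₁ x))

/-- A field of endomorphisms of the tangent spaces is a smooth (1,1)-tensor field. -/
def IsSmoothEndField [IsManifold I 1 M] (φ : Π x : M, TangentSpace I x →L[ℝ] TangentSpace I x) :
    Prop :=
  ContMDiff I (I.prod 𝓘(ℝ, E →L[ℝ] E)) ∞ (fun x ↦ TotalSpace.mk' (E →L[ℝ] E) x (φ x))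

/-- A smooth Riemannian metric on `M`. -/
structure IsRiemannianMetric [IsManifold I 1 M]
    (g : Π x : M, TangentSpace I x →L[ℝ] TangentSpace I x →L[ℝ] ℝ) : Prop where
  symm : ∀ (x : M) (u v : TangentSpace I x), g x u v = g x v u
  pos : ∀ (x : M) (u : TangentSpace I x), u ≠ 0 → 0 < g x u u
  smooth : ContMDiff I (I.prod 𝓘(ℝ, E →L[ℝ] E →L[ℝ] ℝ)) ∞
    (fun x ↦ TotalSpace.mk' (E →L[ℝ] E →L[ℝ] ℝ) x (g x))

/-- The exterior derivative of a 1-form, evaluated on two vector fields, normalised by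
`2 dω₁(X, Y) = X (ω₁ Y) - Y (ω₁ X) - ω₁ [X, Y]`. -/
def dOneForm (ω₁ : Π x : M, TangentSpace I x →L[ℝ] ℝ) (X Y : Π x : M, TangentSpace I x) (x : M) :
    ℝ :=
  (1 / 2 : ℝ) * (mvfderiv I (fun y ↦ ω₁ y (Y y)) x (X x) - mvfderiv I (fun y ↦ ω₁ y (X y)) x (Y x)
    - ω₁ x (VectorField.mlieBracket I X Y x))

/-- `∇` is the Levi-Civita connection of `g`: it is torsion free and compatible with `g`.
Here `cov Y x u` stands for `∇_u Y` at the point `x`. -/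
structure IsLeviCivita [IsManifold I 2 M] [FiniteDimensional ℝ E] [CompleteSpace E]
    (g : Π x : M, TangentSpace I x →L[ℝ] TangentSpace I x →L[ℝ] ℝ)
    (cov : CovariantDerivative I E (TangentSpace I : M → Type _)) : Prop where
  torsion_eq_zero : cov.torsion = 0
  metric : ∀ (x : M) (Y Z : Π x : M, TangentSpace I x),
    MDifferentiableAt I I.tangent (fun y ↦ (⟨y, Y y⟩ : TangentBundle I M)) x →
    MDifferentiableAt I I.tangent (fun y ↦ (⟨y, Z y⟩ : TangentBundle I M)) x →
    ∀ u : TangentSpace I x,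
      mvfderiv I (fun y ↦ g y (Y y) (Z y)) x u = g x (cov Y x u) (Z x) + g x (Y x) (cov Z x u)

/-- `(∇_X φ) Y = ∇_X (φ Y) - φ (∇_X Y)` for a field of endomorphisms `φ`. -/
def covEnd [IsManifold I 1 M] (cov : CovariantDerivative I E (TangentSpace I : M → Type _))
    (φ : Π x : M, TangentSpace I x →L[ℝ] TangentSpace I x)
    (X Y : Π x : M, TangentSpace I x) (x : M) : TangentSpace I x :=
  cov (fun y ↦ φ y (Y y)) x (X x) - φ x (cov Y x (X x))

/-- `(M, J, g)` is an almost Hermitian manifold. -/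
structure IsAlmostHermitian [IsManifold I 1 M]
    (J : Π x : M, TangentSpace I x →L[ℝ] TangentSpace I x)
    (g : Π x : M, TangentSpace I x →L[ℝ] TangentSpace I x →L[ℝ] ℝ) : Prop where
  metric : IsRiemannianMetric g
  smooth : IsSmoothEndField J
  sq : ∀ (x : M) (u : TangentSpace I x), J x (J x u) = -u
  compat : ∀ (x : M) (u v : TangentSpace I x), g x (J x u) (J x v) = g x u v

/-- `(M, J, g)` is a Kähler manifold: an almost Hermitian manifold such that `J` is parallel
for the Levi-Civita connection of `g`. -/
structure IsKaehler [IsManifold I 2 M] [FiniteDimensional ℝ E] [CompleteSpace E]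
    (J : Π x : M, TangentSpace I x →L[ℝ] TangentSpace I x)
    (g : Π x : M, TangentSpace I x →L[ℝ] TangentSpace I x →L[ℝ] ℝ) : Prop where
  almostHermitian : IsAlmostHermitian J g
  parallel : ∃ cov : CovariantDerivative I E (TangentSpace I : M → Type _),
    IsLeviCivita g cov ∧
    ∀ X Y : Π x : M, TangentSpace I x, IsSmoothField X → IsSmoothField Y →
      ∀ x : M, covEnd cov J X Y x = 0

/-- `(φ, ξ, η, g)` is an almost contact metric structure on `M`. (The dimension of `M` is then
automatically odd.) -/
structure IsAlmostContactMetric [IsManifold I 1 M]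
    (φ : Π x : M, TangentSpace I x →L[ℝ] TangentSpace I x)
    (ξ : Π x : M, TangentSpace I x)
    (η : Π x : M, TangentSpace I x →L[ℝ] ℝ)
    (g : Π x : M, TangentSpace I x →L[ℝ] TangentSpace I x →L[ℝ] ℝ) : Prop where
  smooth_phi : IsSmoothEndField φ
  smooth_xi : IsSmoothField ξ
  smooth_eta : IsSmoothOneForm η
  metric : IsRiemannianMetric g
  phi_sq : ∀ (x : M) (u : TangentSpace I x), φ x (φ x u) = -u + η x u • ξ x
  eta_xi : ∀ x : M, η x (ξ x) = 1
  compat : ∀ (x : M) (u v : TangentSpace I x), g x (φ x u) (φ x v) = g x u v - η x u * η x v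

/-- `(φ, ξ, η, g)` is an `α`-Sasakian structure on `M`, for a non-zero constant `α`: an almost
contact metric structure such that `(∇_X φ) Y = α (g(X, Y) ξ - η(Y) X)` for all `X, Y ∈ χ(M)`, where
`∇` is the Levi-Civita connection of `g`. -/
structure IsAlphaSasakian [IsManifold I 2 M] [FiniteDimensional ℝ E] [CompleteSpace E]
    (α : ℝ)
    (φ : Π x : M, TangentSpace I x →L[ℝ] TangentSpace I x)
    (ξ : Π x : M, TangentSpace I x)
    (η : Π x : M, TangentSpace I x →L[ℝ] ℝ)
    (g : Π x : M, TangentSpace I x →L[ℝ] TangentSpace I x →L[ℝ] ℝ) : Prop where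
  ne_zero : α ≠ 0
  almostContactMetric : IsAlmostContactMetric φ ξ η g
  nabla_phi : ∃ cov : CovariantDerivative I E (TangentSpace I : M → Type _),
    IsLeviCivita g cov ∧
    ∀ X Y : Π x : M, TangentSpace I x, IsSmoothField X → IsSmoothField Y →
      ∀ x : M, covEnd cov φ X Y x = α • (g x (X x) (Y x) • ξ x - η x (Y x) • X x)

/-- `(φ, ξ, η, g)` is a Sasakian structure on `M`: an almost contact metric structure such that
`(∇_X φ) Y = g(X, Y) ξ - η(Y) X` for all `X, Y ∈ χ(M)`, where `∇` is the Levi-Civita connection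
of `g`. -/
structure IsSasakian [IsManifold I 2 M] [FiniteDimensional ℝ E] [CompleteSpace E]
    (φ : Π x : M, TangentSpace I x →L[ℝ] TangentSpace I x)
    (ξ : Π x : M, TangentSpace I x)
    (η : Π x : M, TangentSpace I x →L[ℝ] ℝ)
    (g : Π x : M, TangentSpace I x →L[ℝ] TangentSpace I x →L[ℝ] ℝ) : Prop where
  almostContactMetric : IsAlmostContactMetric φ ξ η g
  nabla_phi : ∃ cov : CovariantDerivative I E (TangentSpace I : M → Type _),
    IsLeviCivita g cov ∧
    ∀ X Y : Π x : M, TangentSpace I x, IsSmoothField X → IsSmoothField Y →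
      ∀ x : M, covEnd cov φ X Y x = g x (X x) (Y x) • ξ x - η x (Y x) • X x

end Geometry

/-- An open curve `β : I → E^m`: a smooth regular curve without self-intersections, defined on a
non-empty open interval `I` (possibly unbounded) and not necessarily parametrised by arc length. -/
structure OpenCurve (m : ℕ) where
  /-- the interval `I` -/
  dom : Set ℝ
  isOpen_dom : IsOpen dom
  ordConnected_dom : dom.OrdConnected
  nonempty_dom : dom.Nonempty
  /-- the map `β`; its values outside `I` are irrelevant -/
  toFun : ℝ → EuclideanSpace ℝ (Fin m)
  smooth : ContDiffOn ℝ ∞ toFun dom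
  regular : ∀ t ∈ dom, deriv toFun t ≠ 0
  injOn : Set.InjOn toFun dom

namespace OpenCurve

variable {m : ℕ} (β : OpenCurve m)

/-- The point set `β(I) ⊆ E^m`. -/
def Trace : Type := {p : EuclideanSpace ℝ (Fin m) // p ∈ β.toFun '' β.dom}

/-- The inclusion of `β(I)` in `E^m`. -/
def incl (c : β.Trace) : EuclideanSpace ℝ (Fin m) := c.1

/-- The parameter `t ∈ I` of the point `β(t)` of `β(I)`. -/
def param (c : β.Trace) : ℝ := Classical.choose c.2

lemma param_mem (c : β.Trace) : β.param c ∈ β.dom := (Classical.choose_spec c.2).1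

lemma toFun_param (c : β.Trace) : β.toFun (β.param c) = β.incl c := (Classical.choose_spec c.2).2

/-- The point `β(t)` of `β(I)`. -/
def point (t : ℝ) (ht : t ∈ β.dom) : β.Trace := ⟨β.toFun t, t, ht, rfl⟩

lemma param_point (t : ℝ) (ht : t ∈ β.dom) : β.param (β.point t ht) = t :=
  β.injOn (β.param_mem _) ht (β.toFun_param _)

lemma param_injective : Function.Injective β.param := fun c d h ↦
  Subtype.ext (by
    have hc := β.toFun_param c
    have hd := β.toFun_param d
    rw [h] at hc
    exact hc.symm.trans hd)

lemma range_param : Set.range β.param = β.dom := by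
  ext t
  constructor
  · rintro ⟨c, rfl⟩
    exact β.param_mem c
  · exact fun ht ↦ ⟨β.point t ht, β.param_point t ht⟩

instance : Nonempty β.Trace := ⟨β.point _ β.nonempty_dom.some_mem⟩

/-- `β(I)` carries the manifold structure for which `β : I → β(I)` is a diffeomorphism: its topology
and its (global) chart are given by the parameter. -/
instance : TopologicalSpace β.Trace := TopologicalSpace.induced β.param inferInstance

lemma isOpenEmbedding_param : Topology.IsOpenEmbedding β.param where
  eq_induced := rfl
  injective := β.param_injective
  isOpen_range := by rw [range_param]; exact β.isOpen_dom

instance : ChartedSpace ℝ β.Trace := β.isOpenEmbedding_param.singletonChartedSpace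

instance : IsManifold 𝓘(ℝ, ℝ) ∞ β.Trace := β.isOpenEmbedding_param.isManifold_singleton

/-- The unit tangent vector field `T` of `β`, as a vector field on the manifold `β(I)`. In the
coordinate `t` it is `‖β'(t)‖⁻¹ d/dt`; its image in `E^m` is `β'(t) / ‖β'(t)‖`. -/
def unitTangent (c : β.Trace) : TangentSpace 𝓘(ℝ, ℝ) c :=
  (‖deriv β.toFun (β.param c)‖⁻¹ : ℝ)

/-- The coordinate `h` of a tangent vector `h T` of `β(I)`. -/
def coord (c : β.Trace) : TangentSpace 𝓘(ℝ, ℝ) c →L[ℝ] ℝ :=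
  ‖deriv β.toFun (β.param c)‖ • ContinuousLinearMap.id ℝ ℝ

lemma coord_unitTangent (c : β.Trace) : β.coord c (β.unitTangent c) = 1 :=
  mul_inv_cancel₀ (norm_ne_zero_iff.2 (β.regular _ (β.param_mem c)))

lemma coord_smul_unitTangent (c : β.Trace) (v : TangentSpace 𝓘(ℝ, ℝ) c) :
    β.coord c v • β.unitTangent c = v := by
  have h : ‖deriv β.toFun (β.param c)‖ ≠ 0 :=
    norm_ne_zero_iff.2 (β.regular _ (β.param_mem c))
  have key : ∀ w : ℝ, ‖deriv β.toFun (β.param c)‖ * w * ‖deriv β.toFun (β.param c)‖⁻¹ = w :=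
    fun w ↦ by field_simp
  exact key v

end OpenCurve

section Product

variable {n m : ℕ} {M₁ : Type*} [TopologicalSpace M₁]
  [ChartedSpace (EuclideanSpace ℝ (Fin (2 * n))) M₁]

/-- The model of `M₁ × β(I)`, where `M₁` is a manifold of dimension `2n`. -/
abbrev prodModel (n : ℕ) := (𝓡 (2 * n)).prod 𝓘(ℝ, ℝ)

/-- The first component of a tangent vector `(X₁, v)` of `M₁ × β(I)`. -/
def tangentFst (β : OpenCurve m) (p : M₁ × β.Trace) :
    TangentSpace (prodModel n) p →L[ℝ] TangentSpace (𝓡 (2 * n)) p.1 :=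
  ContinuousLinearMap.fst ℝ (TangentSpace (𝓡 (2 * n)) p.1) (TangentSpace 𝓘(ℝ, ℝ) p.2)

/-- The second component of a tangent vector `(X₁, v)` of `M₁ × β(I)`. -/
def tangentSnd (β : OpenCurve m) (p : M₁ × β.Trace) :
    TangentSpace (prodModel n) p →L[ℝ] TangentSpace 𝓘(ℝ, ℝ) p.2 :=
  ContinuousLinearMap.snd ℝ (TangentSpace (𝓡 (2 * n)) p.1) (TangentSpace 𝓘(ℝ, ℝ) p.2)

/-- The tangent vector `(X₁, h T)` of `M₁ × β(I)`. -/
def tangentPair (β : OpenCurve m) (p : M₁ × β.Trace) (X₁ : TangentSpace (𝓡 (2 * n)) p.1) (h : ℝ) :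
    TangentSpace (prodModel n) p :=
  (X₁, h • β.unitTangent p.2)

/-- `η̄(X₁, h T) = α ω₁(X₁) + h`. -/
def etaBar (β : OpenCurve m) (α : ℝ) (ω₁ : Π x : M₁, TangentSpace (𝓡 (2 * n)) x →L[ℝ] ℝ)
    (p : M₁ × β.Trace) : TangentSpace (prodModel n) p →L[ℝ] ℝ :=
  α • (ω₁ p.1 ∘L tangentFst β p) + β.coord p.2 ∘L tangentSnd β p

/-- `ξ̄ = (0, T)`. -/
def xiBar (β : OpenCurve m) (p : M₁ × β.Trace) : TangentSpace (prodModel n) p :=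
  tangentPair β p 0 1

/-- `φ̄(X₁, h T) = (J X₁, -α ω₁(J X₁) T)`. -/
def phiBar (β : OpenCurve m) (α : ℝ)
    (J : Π x : M₁, TangentSpace (𝓡 (2 * n)) x →L[ℝ] TangentSpace (𝓡 (2 * n)) x)
    (ω₁ : Π x : M₁, TangentSpace (𝓡 (2 * n)) x →L[ℝ] ℝ)
    (p : M₁ × β.Trace) : TangentSpace (prodModel n) p →L[ℝ] TangentSpace (prodModel n) p :=
  (J p.1 ∘L tangentFst β p).prod
    ((-α • (ω₁ p.1 ∘L J p.1 ∘L tangentFst β p)).smulRight (β.unitTangent p.2))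

/-- `g = g₁ + η̄ ⊗ η̄`. -/
def gBar (β : OpenCurve m) (α : ℝ)
    (g₁ : Π x : M₁, TangentSpace (𝓡 (2 * n)) x →L[ℝ] TangentSpace (𝓡 (2 * n)) x →L[ℝ] ℝ)
    (ω₁ : Π x : M₁, TangentSpace (𝓡 (2 * n)) x →L[ℝ] ℝ)
    (p : M₁ × β.Trace) :
    TangentSpace (prodModel n) p →L[ℝ] TangentSpace (prodModel n) p →L[ℝ] ℝ :=
  (ContinuousLinearMap.precomp ℝ (tangentFst β p)) ∘L g₁ p.1 ∘L tangentFst β p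
    + (etaBar β α ω₁ p).smulRight (etaBar β α ω₁ p)

end Product

end

/-! Put X^h = (X, -α ω(X) T), the lift of a field X on M₁ to the kernel of η̄. Then g restricted to
lifts is g₁ pulled back, and ξ̄ is a unit field orthogonal to all lifts, so M → M₁ is a Riemannian
submersion whose fibres are tangent to ξ̄. Everything depends on three brackets: [X^h, ξ̄] = 0,
[X^h, Y^h] projects to [X, Y], and η̄[X^h, Y^h] = -2α dω(X, Y) = -2α g₁(X, JY)
(`mlieBracket_liftField_xiBar`, `tangentFst_mlieBracket_liftField`, `etaBar_mlieBracket_liftField`).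

The brackets are found without product coordinates: a function f satisfies df[V, W] = V(Wf) - W(Vf)
(`mvfderiv_mlieBracket`). This is applied to a chart of M₁ composed with the projection, which
detects the base component, and to the arc length of β, whose differential is the coordinate h.

The Koszul formula then gives ∇_{X^h} Y^h = (∇̃_X Y)^h - α g₁(X, JY) ξ̄, ∇_{X^h} ξ̄ = ∇_{ξ̄} X^h =
-α (JX)^h and ∇_{ξ̄} ξ̄ = 0. As φ̄ Y^h = (JY)^h, φ̄ ξ̄ = 0, ∇̃J = 0 and J² = -1, the derivative ∇φ̄
has the required values on lifts and on ξ̄. It is tensorial, and lifts together with ξ̄ span every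
tangent space, so `covEnd_phiBar` follows for all fields.

Existence of the Levi-Civita connection is proved for any Riemannian metric by reading the Koszul
formula as a definition (`IsRiemannianMetric.exists_isLeviCivita`). If the structure is Sasakian,
comparing the two formulas for (∇_{X^h} φ̄) ξ̄ at a point where X ≠ 0 forces α = 1. -/

noncomputable section

/-! ### The Lie bracket as a commutator of derivations -/

section BracketDerivation

variable {E : Type*} [NormedAddCommGroup E] [NormedSpace ℝ E]
  {H : Type*} [TopologicalSpace H] {I : ModelWithCorners ℝ E H}
  {M : Type*} [TopologicalSpace M] [ChartedSpace H M]
  {F : Type*} [NormedAddCommGroup F] [NormedSpace ℝ F]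

/-- The expression of the vector field `V` in the preferred chart at `x`. -/
def fieldInChart (x : M) (V : Π y : M, TangentSpace I y) : E → E :=
  VectorField.mpullbackWithin 𝓘(ℝ, E) I (extChartAt I x).symm V (Set.range I)

open VectorField Set in
/-- The derivative of `f` along `V`, read in a chart. -/
lemma mvfderiv_apply_eq_fderivWithin_fieldInChart [IsManifold I 1 M] {f : M → F} {x : M} {z : E}
    (hz : z ∈ (extChartAt I x).target)
    (hf : MDifferentiableAt I 𝓘(ℝ, F) f ((extChartAt I x).symm z))
    (V : Π y : M, TangentSpace I y) :
    mvfderiv I f ((extChartAt I x).symm z) (V ((extChartAt I x).symm z)) =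
      fderivWithin ℝ (f ∘ (extChartAt I x).symm) (range I) z (fieldInChart x V z) := by
  have hs := mdifferentiableWithinAt_extChartAt_symm (I := I) hz
  have U : UniqueMDiffWithinAt 𝓘(ℝ, E) (range I) z :=
    I.uniqueMDiffOn _ (extChartAt_target_subset_range x hz)
  have hinv := isInvertible_mfderivWithin_extChartAt_symm (I := I) hz
  have h2 : (mfderivWithin 𝓘(ℝ, E) I (extChartAt I x).symm (range I) z)
      (fieldInChart (E := E) x V z) = V ((extChartAt I x).symm z) := hinv.self_apply_inverse _
  -- The derivative of the inverse chart is invertible, so it carries the chart expression of V back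
  -- to V; the chain rule does the rest.
  rw [← h2]
  have h1 : fderivWithin ℝ (f ∘ (extChartAt I x).symm) (range I) z =
      (mfderiv I 𝓘(ℝ, F) f ((extChartAt I x).symm z)) ∘L
        (mfderivWithin 𝓘(ℝ, E) I (extChartAt I x).symm (range I) z) := by
    rw [← mfderivWithin_eq_fderivWithin]
    exact mfderiv_comp_mfderivWithin z hf hs U
  rw [h1]
  rfl

open VectorField Set in
/-- A vector-valued function `f` satisfies `df [V, W] = V (W f) - W (V f)`. -/
lemma mvfderiv_mlieBracket [IsManifold I 2 M] [CompleteSpace E] {f : M → F} {x : M}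
    (hf : ContMDiffAt I 𝓘(ℝ, F) 2 f x)
    {V W : Π y : M, TangentSpace I y}
    (hV : MDifferentiableAt I I.tangent (fun y ↦ (⟨y, V y⟩ : TangentBundle I M)) x)
    (hW : MDifferentiableAt I I.tangent (fun y ↦ (⟨y, W y⟩ : TangentBundle I M)) x)
    (hVf : MDifferentiableAt I 𝓘(ℝ, F) (fun y ↦ mvfderiv I f y (V y)) x)
    (hWf : MDifferentiableAt I 𝓘(ℝ, F) (fun y ↦ mvfderiv I f y (W y)) x) :
    mvfderiv I f x (mlieBracket I V W x) =
      mvfderiv I (fun y ↦ mvfderiv I f y (W y)) x (V x)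
        - mvfderiv I (fun y ↦ mvfderiv I f y (V y)) x (W x) := by
  have hx : extChartAt I x x ∈ (extChartAt I x).target := mem_extChartAt_target x
  have hxx := extChartAt_to_inv (I := I) x
  have hev : ∀ᶠ z in 𝓝[range I] (extChartAt I x x), z ∈ (extChartAt I x).target ∧
      MDifferentiableAt I 𝓘(ℝ, F) f ((extChartAt I x).symm z) := by
    have h1 : ∀ᶠ y in 𝓝 x, MDifferentiableAt I 𝓘(ℝ, F) f y :=
      ((contMDiffAt_iff_contMDiffAt_nhds (by simp)).1 hf).mono
        fun y hy ↦ hy.mdifferentiableAt (by simp)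
    have h2 : Filter.Tendsto (extChartAt I x).symm (𝓝 (extChartAt I x x)) (𝓝 x) := by
      have := continuousAt_extChartAt_symm (I := I) x
      rwa [ContinuousAt, hxx] at this
    filter_upwards [extChartAt_target_mem_nhdsWithin x,
      (h2.eventually h1).filter_mono nhdsWithin_le_nhds] with z hz hz' using ⟨hz, hz'⟩
  have key (X Y : Π y : M, TangentSpace I y)
      (hX : MDifferentiableAt I 𝓘(ℝ, F) (fun y ↦ mvfderiv I f y (X y)) x) :
      mvfderiv I (fun y ↦ mvfderiv I f y (X y)) x (Y x) =
      fderivWithin ℝ (fun z ↦ fderivWithin ℝ (f ∘ (extChartAt I x).symm) (range I) z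
        (fieldInChart x X z)) (range I) (extChartAt I x x)
        (fieldInChart x Y (extChartAt I x x)) := by
    have h := mvfderiv_apply_eq_fderivWithin_fieldInChart hx (by rwa [hxx]) Y
      (f := fun y ↦ mvfderiv I f y (X y))
    rw [hxx] at h
    rw [h]
    congr 1
    apply Filter.EventuallyEq.fderivWithin_eq
    · filter_upwards [hev] with z hz
      exact mvfderiv_apply_eq_fderivWithin_fieldInChart hz.1 hz.2 X
    · exact mvfderiv_apply_eq_fderivWithin_fieldInChart hx
        (by rw [hxx]; exact hf.mdifferentiableAt (by simp)) X
  have hfd : ContDiffWithinAt ℝ 2 (f ∘ (extChartAt I x).symm) (range I) (extChartAt I x x) :=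
    (contMDiffAt_iff.1 hf).2
  have hdiff {X : Π y : M, TangentSpace I y}
      (hX : MDifferentiableAt I I.tangent (fun y ↦ (⟨y, X y⟩ : TangentBundle I M)) x) :
      DifferentiableWithinAt ℝ (fieldInChart x X) (range I) (extChartAt I x x) := by
    have := (hX.mdifferentiableWithinAt
      (s := univ)).differentiableWithinAt_mpullbackWithin_vectorField
    rwa [preimage_univ, univ_inter] at this
  -- The bracket on M is pulled back from the model space by the derivative of the chart at x, which
  -- is the identity at its own base point.
  have hbr : mlieBracket I V W x = (lieBracketWithin ℝ (fieldInChart x V) (fieldInChart x W)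
      (range I) (extChartAt I x x) : E) := by
    have hid (v : E) : (ContinuousLinearMap.id ℝ E).inverse v = v := by
      rw [ContinuousLinearMap.inverse_id]; rfl
    rw [mlieBracket, mlieBracketWithin_apply, preimage_univ, univ_inter, mfderiv_extChartAt_self]
    exact hid _
  -- In the model space the identity amounts to the symmetry of the second derivative within `range
  -- I`, which lies in the closure of its interior.
  rw [key W V hWf, key V W hVf,
    ← fderivWithin_apply_lieBracket (n := 2) hfd (by simp) I.uniqueDiffOn
      (I.range_subset_closure_interior (mem_range_self _)) (mem_range_self _) (hdiff hW) (hdiff hV),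
    hbr, (hf.mdifferentiableAt (by simp)).mvfderiv]
  rfl

end BracketDerivation

/-! ### Global extension of tangent vectors -/

section Extension

variable {E : Type*} [NormedAddCommGroup E] [NormedSpace ℝ E]
  {H : Type*} [TopologicalSpace H] {I : ModelWithCorners ℝ E H}
  {M : Type*} [TopologicalSpace M] [ChartedSpace H M] [IsManifold I ∞ M]

lemma IsSmoothField.mdifferentiableAt {X : Π x : M, TangentSpace I x} (hX : IsSmoothField X)
    (x : M) : MDifferentiableAt I I.tangent (fun y ↦ (⟨y, X y⟩ : TangentBundle I M)) x :=
  (hX x).mdifferentiableAt (by simp)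

/-- Every tangent vector is the value of a globally smooth vector field. -/
lemma exists_isSmoothField_apply_eq [FiniteDimensional ℝ E] [T2Space M] (x : M)
    (v : TangentSpace I x) :
    ∃ X : Π y : M, TangentSpace I y, IsSmoothField X ∧ X x = v := by
  obtain ⟨s, hs, hsm⟩ := FiberBundle.exists_contMDiffOn_extend (k := ∞) I E v
  obtain ⟨u, hus, hu, hxu⟩ := mem_nhds_iff.1 hs
  obtain ⟨f, -, hf⟩ := (SmoothBumpFunction.nhds_basis_tsupport (I := I) x).mem_iff.1
    (hu.mem_nhds hxu)
  refine ⟨(f : M → ℝ) • FiberBundle.extend E v, ?_, ?_⟩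
  · exact ContMDiffOn.smul_section_of_tsupport f.contMDiff.contMDiffOn hu hf (hsm.mono hus)
  · simp

end Extension

/-! ### Smoothness of tensor fields tested on vector fields -/

section HomBundle

variable {E : Type*} [NormedAddCommGroup E] [NormedSpace ℝ E] [FiniteDimensional ℝ E]
  {H : Type*} [TopologicalSpace H] {I : ModelWithCorners ℝ E H}
  {M : Type*} [TopologicalSpace M] [ChartedSpace H M]
  {F : Type*} [NormedAddCommGroup F] [NormedSpace ℝ F]

/-- A map into `E →L[ℝ] F`, with `E` finite-dimensional, is smooth if its evaluations are. -/
lemma contMDiffAt_clm_of_apply {n : ℕ∞ω} {L : M → E →L[ℝ] F} {x : M}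
    (h : ∀ e : E, ContMDiffAt I 𝓘(ℝ, F) n (fun y ↦ L y e) x) :
    ContMDiffAt I 𝓘(ℝ, E →L[ℝ] F) n L x := by
  let b := Module.finBasis ℝ E
  -- A linear map is the sum of its values on a basis times the dual basis, with coefficients
  -- independent of the point.
  have hL : L = fun y ↦ ∑ i, ContinuousLinearMap.smulRightL ℝ E F
      (LinearMap.toContinuousLinearMap (b.coord i)) (L y (b i)) := by
    ext y e
    conv_lhs => rw [← b.sum_repr e]
    rw [map_sum]
    simp
  rw [hL]
  refine contMDiffAt_finsetSum fun i _ ↦ ?_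
  exact (ContinuousLinearMap.contMDiff _).contMDiffAt.comp x (h (b i))

variable [IsManifold I ∞ M] {V : M → Type*} [TopologicalSpace (TotalSpace F V)]
  [∀ x, AddCommGroup (V x)] [∀ x, Module ℝ (V x)] [∀ x, TopologicalSpace (V x)]
  [∀ x, IsTopologicalAddGroup (V x)] [∀ x, ContinuousSMul ℝ (V x)]
  [FiberBundle F V] [VectorBundle ℝ F V]

/-- A section of `Hom(TM, V)` is smooth at a point if it maps smooth vector fields to smooth
sections. -/
lemma contMDiffAt_hom_of_apply {x : M} {φ : Π x : M, TangentSpace I x →L[ℝ] V x}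
    (h : ∀ X : Π x : M, TangentSpace I x,
      ContMDiffAt I I.tangent ∞ (fun y ↦ (⟨y, X y⟩ : TangentBundle I M)) x →
      ContMDiffAt I (I.prod 𝓘(ℝ, F)) ∞ (fun y ↦ TotalSpace.mk' F y (φ y (X y))) x) :
    ContMDiffAt I (I.prod 𝓘(ℝ, E →L[ℝ] F)) ∞
      (fun x ↦ TotalSpace.mk' (E →L[ℝ] F) (E := fun x ↦ TangentSpace I x →L[ℝ] V x) x (φ x))
      x := by
  rw [contMDiffAt_hom_bundle]
  refine ⟨contMDiffAt_id, contMDiffAt_clm_of_apply fun e ↦ ?_⟩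
  -- The test field has constant coordinate e in the trivialization at x, so the coordinates of its
  -- image are the coordinate expression of φ evaluated at e.
  have h1 := h (FiberBundle.extend E (x := x)
      ((trivializationAt E (TangentSpace I) x).symm x e)) (FiberBundle.contMDiffAt_extend I E _)
  rw [contMDiffAt_section] at h1
  refine h1.congr_of_eventuallyEq ?_
  filter_upwards [(trivializationAt E (TangentSpace I) x).open_baseSet.mem_nhds
      (FiberBundle.mem_baseSet_trivializationAt' x),
    (trivializationAt F V x).open_baseSet.mem_nhds
      (FiberBundle.mem_baseSet_trivializationAt' x)] with y hy hy'
  rw [ContinuousLinearMap.inCoordinates_eq hy hy']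
  have he : (trivializationAt E (TangentSpace I) x
      ⟨x, (trivializationAt E (TangentSpace I) x).symm x e⟩).2 = e := by
    rw [Trivialization.apply_mk_symm _ (FiberBundle.mem_baseSet_trivializationAt' x)]
  simp [FiberBundle.extend, he]

end HomBundle

/-! ### The Koszul formula and the Levi-Civita connection -/

section Koszul

open VectorField

variable {E : Type*} [NormedAddCommGroup E] [NormedSpace ℝ E]
  {H : Type*} [TopologicalSpace H] {I : ModelWithCorners ℝ E H}
  {M : Type*} [TopologicalSpace M] [ChartedSpace H M]

/-- The right-hand side of the Koszul formula for `2 g(∇_X Y, Z)`. -/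
def koszul (g : Π x : M, TangentSpace I x →L[ℝ] TangentSpace I x →L[ℝ] ℝ)
    (X Y Z : Π x : M, TangentSpace I x) (x : M) : ℝ :=
  mvfderiv I (fun y ↦ g y (Y y) (Z y)) x (X x) + mvfderiv I (fun y ↦ g y (X y) (Z y)) x (Y x)
    - mvfderiv I (fun y ↦ g y (X y) (Y y)) x (Z x) + g x (mlieBracket I X Y x) (Z x)
    - g x (mlieBracket I X Z x) (Y x) - g x (mlieBracket I Y Z x) (X x)

/-- Differentiability of a vector field at a point. -/
abbrev FieldDiffAt [IsManifold I 1 M] (X : Π x : M, TangentSpace I x) (x : M) : Prop :=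
  MDifferentiableAt I I.tangent (fun y ↦ (⟨y, X y⟩ : TangentBundle I M)) x

variable [IsManifold I ∞ M]
  {g : Π x : M, TangentSpace I x →L[ℝ] TangentSpace I x →L[ℝ] ℝ} {x : M}

lemma IsRiemannianMetric.mdifferentiableAt_apply (hg : IsRiemannianMetric g)
    {X Y : Π x : M, TangentSpace I x} (hX : FieldDiffAt X x) (hY : FieldDiffAt Y x) :
    MDifferentiableAt I 𝓘(ℝ, ℝ) (fun y ↦ g y (X y) (Y y)) x := by
  have h := MDifferentiableAt.clm_bundle_apply₂ (F₁ := E) (F₂ := E) (F₃ := ℝ)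
    (E₃ := Bundle.Trivial M ℝ)
    ((hg.smooth x).mdifferentiableAt (by simp)) hX hY
  exact ((mdifferentiableAt_totalSpace ..).1 h).2

lemma IsRiemannianMetric.eq_of_forall_apply_eq (hg : IsRiemannianMetric g)
    {u v : TangentSpace I x} (h : ∀ w, g x u w = g x v w) : u = v := by
  by_contra hne
  have := hg.pos x (u - v) (sub_ne_zero.2 hne)
  simp only [map_sub, sub_apply, h, sub_self] at this
  exact this.false

variable [CompleteSpace E]
section
variable {X X' Y Y' Z Z' : Π x : M, TangentSpace I x} {f : M → ℝ}

lemma koszul_add_left (hg : IsRiemannianMetric g)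
    (hX : FieldDiffAt X x) (hX' : FieldDiffAt X' x) (hY : FieldDiffAt Y x) (hZ : FieldDiffAt Z x) :
    koszul g (X + X') Y Z x = koszul g X Y Z x + koszul g X' Y Z x := by
  simp only [koszul, Pi.add_apply, map_add, add_apply,
    mlieBracket_add_left hX hX',
    mvfderiv_fun_add (hg.mdifferentiableAt_apply hX hZ) (hg.mdifferentiableAt_apply hX' hZ),
    mvfderiv_fun_add (hg.mdifferentiableAt_apply hX hY) (hg.mdifferentiableAt_apply hX' hY)]
  ring

/-- The derivatives of f produced by the product rule cancel those produced by the brackets; this is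
tensoriality in the direction of differentiation. -/
lemma koszul_smul_left (hg : IsRiemannianMetric g) (hf : MDifferentiableAt I 𝓘(ℝ, ℝ) f x)
    (hX : FieldDiffAt X x) (hY : FieldDiffAt Y x) (hZ : FieldDiffAt Z x) :
    koszul g (f • X) Y Z x = f x * koszul g X Y Z x := by
  simp only [koszul, Pi.smul_apply', map_smul, map_add, add_apply,
    smul_apply, smul_eq_mul,
    mlieBracket_smul_left hf hX,
    mvfderiv_fun_mul hf (hg.mdifferentiableAt_apply hX hZ),
    mvfderiv_fun_mul hf (hg.mdifferentiableAt_apply hX hY)]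
  rw [hg.symm x (X x) (Z x), hg.symm x (X x) (Y x)]
  ring

lemma koszul_add_right (hg : IsRiemannianMetric g)
    (hX : FieldDiffAt X x) (hY : FieldDiffAt Y x) (hZ : FieldDiffAt Z x) (hZ' : FieldDiffAt Z' x) :
    koszul g X Y (Z + Z') x = koszul g X Y Z x + koszul g X Y Z' x := by
  simp only [koszul, Pi.add_apply, map_add, add_apply,
    mlieBracket_add_right hZ hZ',
    mvfderiv_fun_add (hg.mdifferentiableAt_apply hX hZ) (hg.mdifferentiableAt_apply hX hZ'),
    mvfderiv_fun_add (hg.mdifferentiableAt_apply hY hZ) (hg.mdifferentiableAt_apply hY hZ')]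
  ring

lemma koszul_smul_right (hg : IsRiemannianMetric g) (hf : MDifferentiableAt I 𝓘(ℝ, ℝ) f x)
    (hX : FieldDiffAt X x) (hY : FieldDiffAt Y x) (hZ : FieldDiffAt Z x) :
    koszul g X Y (f • Z) x = f x * koszul g X Y Z x := by
  simp only [koszul, Pi.smul_apply', map_smul, map_add, add_apply,
    smul_apply, smul_eq_mul, mlieBracket_smul_right hf hZ,
    mvfderiv_fun_mul hf (hg.mdifferentiableAt_apply hX hZ),
    mvfderiv_fun_mul hf (hg.mdifferentiableAt_apply hY hZ)]
  rw [hg.symm x (Z x) (Y x), hg.symm x (Z x) (X x)]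
  ring

lemma koszul_add_middle (hg : IsRiemannianMetric g)
    (hX : FieldDiffAt X x) (hY : FieldDiffAt Y x) (hY' : FieldDiffAt Y' x) (hZ : FieldDiffAt Z x) :
    koszul g X (Y + Y') Z x = koszul g X Y Z x + koszul g X Y' Z x := by
  simp only [koszul, Pi.add_apply, map_add, add_apply,
    mlieBracket_add_right hY hY', mlieBracket_add_left hY hY',
    mvfderiv_fun_add (hg.mdifferentiableAt_apply hX hY) (hg.mdifferentiableAt_apply hX hY'),
    mvfderiv_fun_add (hg.mdifferentiableAt_apply hY hZ) (hg.mdifferentiableAt_apply hY' hZ)]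
  ring

/-- Here the two terms in X(f) add up instead of cancelling, which is the Leibniz rule for the
connection; the terms in Z(f) still cancel. -/
lemma koszul_smul_middle (hg : IsRiemannianMetric g) (hf : MDifferentiableAt I 𝓘(ℝ, ℝ) f x)
    (hX : FieldDiffAt X x) (hY : FieldDiffAt Y x) (hZ : FieldDiffAt Z x) :
    koszul g X (f • Y) Z x =
      f x * koszul g X Y Z x + 2 * (mvfderiv I f x (X x) * g x (Y x) (Z x)) := by
  simp only [koszul, Pi.smul_apply', map_smul, map_add, add_apply,
    smul_apply, smul_eq_mul, mlieBracket_smul_right hf hY, mlieBracket_smul_left hf hY,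
    mvfderiv_fun_mul hf (hg.mdifferentiableAt_apply hX hY),
    mvfderiv_fun_mul hf (hg.mdifferentiableAt_apply hY hZ)]
  rw [hg.symm x (Y x) (X x)]
  ring

/-- The Koszul expression is determined by a metric torsion-free connection. -/
lemma IsLeviCivita.two_mul_apply_eq_koszul [FiniteDimensional ℝ E] (hg : IsRiemannianMetric g)
    {cov : CovariantDerivative I E (TangentSpace I : M → Type _)} (h : IsLeviCivita g cov)
    (hX : FieldDiffAt X x) (hY : FieldDiffAt Y x) (hZ : FieldDiffAt Z x) :
    2 * g x (cov Y x (X x)) (Z x) = koszul g X Y Z x := by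
  have ht {X Y : Π x : M, TangentSpace I x} (hX : FieldDiffAt X x) (hY : FieldDiffAt Y x) :
      cov Y x (X x) - cov X x (Y x) = mlieBracket I X Y x :=
    cov.torsion_eq_zero_iff.1 h.torsion_eq_zero hX hY
  simp only [koszul, ← ht hX hY, ← ht hX hZ, ← ht hY hZ, h.metric x _ _ hY hZ,
    h.metric x _ _ hX hZ, h.metric x _ _ hX hY, map_sub, sub_apply]
  rw [hg.symm x (Y x) (cov Z x (X x)), hg.symm x (X x) (cov Z x (Y x)),
    hg.symm x (X x) (cov Y x (Z x))]
  ring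

end

section Existence

/-- Positivity makes B injective as a map into the dual, hence an isomorphism by dimension, and S is
its inverse applied to K. -/
lemma exists_clm_representing {V : Type*} [AddCommGroup V] [Module ℝ V] [TopologicalSpace V]
    [IsTopologicalAddGroup V] [ContinuousSMul ℝ V] [T2Space V] [FiniteDimensional ℝ V]
    (B K : V →L[ℝ] V →L[ℝ] ℝ) (hB : ∀ u, u ≠ 0 → 0 < B u u) :
    ∃ S : V →L[ℝ] V, ∀ u w, B (S u) w = K u w := by
  let B' : V →ₗ[ℝ] Module.Dual ℝ V := (ContinuousLinearMap.coeLM ℝ) ∘ₗ B.toLinearMap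
  let K' : V →ₗ[ℝ] Module.Dual ℝ V := (ContinuousLinearMap.coeLM ℝ) ∘ₗ K.toLinearMap
  have hinj : Function.Injective B' := by
    rw [← LinearMap.ker_eq_bot, LinearMap.ker_eq_bot']
    intro u hu
    by_contra hne
    have h1 := hB u hne
    have h2 : B u u = 0 := DFunLike.congr_fun hu u
    exact h1.ne' h2
  let e := B'.linearEquivOfInjective hinj (Subspace.dual_finrank_eq).symm
  refine ⟨LinearMap.toContinuousLinearMap (e.symm.toLinearMap ∘ₗ K'), fun u w ↦ ?_⟩
  have : B' (e.symm (K' u)) = K' u := e.apply_symm_apply (K' u)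
  exact DFunLike.congr_fun this w

variable [FiniteDimensional ℝ E]

/-- For fixed Y the Koszul expression is tensorial in X and Z, so it is a bilinear form at x; half
of it, represented through the metric, is the candidate for u ↦ ∇_u Y. -/
lemma exists_clm_koszul (hg : IsRiemannianMetric g) (x : M) {Y : Π x : M, TangentSpace I x}
    (hY : FieldDiffAt Y x) :
    ∃ S : TangentSpace I x →L[ℝ] TangentSpace I x, ∀ X Z : Π x : M, TangentSpace I x,
      FieldDiffAt X x → FieldDiffAt Z x → 2 * g x (S (X x)) (Z x) = koszul g X Y Z x := by
  let K : TangentSpace I x →L[ℝ] TangentSpace I x →L[ℝ] ℝ :=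
    TensorialAt.mkHom₂ (fun X Z ↦ koszul g X Y Z x) x
      (fun Z hZ ↦ ⟨fun hf hX ↦ koszul_smul_left hg hf hX hY hZ,
        fun hX hX' ↦ koszul_add_left hg hX hX' hY hZ⟩)
      (fun X hX ↦ ⟨fun hf hZ ↦ koszul_smul_right hg hf hX hY hZ,
        fun hZ hZ' ↦ koszul_add_right hg hX hY hZ hZ'⟩)
  have : FiniteDimensional ℝ (TangentSpace I x) := inferInstanceAs (FiniteDimensional ℝ E)
  have : T2Space (TangentSpace I x) := inferInstanceAs (T2Space E)
  obtain ⟨S, hS⟩ := exists_clm_representing (g x) ((1 / 2 : ℝ) • K) (hg.pos x)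
  refine ⟨S, fun X Z hX hZ ↦ ?_⟩
  have : K (X x) (Z x) = koszul g X Y Z x := TensorialAt.mkHom₂_apply _ _ hX hZ
  rw [hS, ← this]
  simp

/-- Existence of the Levi-Civita connection of a Riemannian metric. -/
theorem IsRiemannianMetric.exists_isLeviCivita (hg : IsRiemannianMetric g) :
    ∃ cov : CovariantDerivative I E (TangentSpace I : M → Type _), IsLeviCivita g cov := by
  choose S hS using fun (x : M) (Y : Π x : M, TangentSpace I x) (hY : FieldDiffAt Y x) ↦
    exists_clm_koszul hg x hY
  classical
  -- The value 0 at points where Y is not differentiable is harmless: the axioms of a connection,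
  -- torsion-freeness and compatibility with g concern differentiable sections only.
  let D (Y : Π x : M, TangentSpace I x) (x : M) : TangentSpace I x →L[ℝ] TangentSpace I x :=
    if hY : FieldDiffAt Y x then S x Y hY else 0
  have hD {X Y Z : Π x : M, TangentSpace I x} {x : M} (hX : FieldDiffAt X x)
      (hY : FieldDiffAt Y x) (hZ : FieldDiffAt Z x) :
      2 * g x (D Y x (X x)) (Z x) = koszul g X Y Z x := by
    simp only [D, dif_pos hY]
    exact hS x Y hY X Z hX hZ
  have hext {x : M} (u : TangentSpace I x) : FieldDiffAt (FiberBundle.extend E u) x :=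
    FiberBundle.mdifferentiableAt_extend I E u
  have hD' {Y : Π x : M, TangentSpace I x} {x : M} (hY : FieldDiffAt Y x) (u w : TangentSpace I x) :
      2 * g x (D Y x u) w = koszul g (FiberBundle.extend E u) Y (FiberBundle.extend E w) x := by
    simpa using hD (hext u) hY (hext w)
  refine ⟨⟨D, ⟨?_, ?_⟩⟩, ?_, ?_⟩
  · intro Y Y' x hY hY' _
    ext1 u
    refine hg.eq_of_forall_apply_eq fun w ↦ ?_
    have h1 := hD' (mdifferentiableAt_add_section hY hY') u w
    rw [koszul_add_middle hg (hext u) hY hY' (hext w), ← hD' hY, ← hD' hY'] at h1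
    simp only [add_apply, map_add]
    linarith
  · intro Y f x hY hf _
    ext1 u
    refine hg.eq_of_forall_apply_eq fun w ↦ ?_
    have h1 := hD' (hf.smul_section hY) u w
    rw [koszul_smul_middle hg hf (hext u) hY (hext w), ← hD' hY] at h1
    simp only [FiberBundle.extend_apply_self] at h1
    simp only [add_apply, map_add, smul_apply, map_smul, ContinuousLinearMap.smulRight_apply,
      smul_eq_mul]
    linarith
  · rw [CovariantDerivative.torsion_eq_zero_iff]
    intro X Y x hX hY
    refine hg.eq_of_forall_apply_eq fun w ↦ ?_
    have h1 := hD hX hY (hext w)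
    have h2 := hD hY hX (hext w)
    -- The part of the Koszul expression antisymmetric in X and Y is the bracket term alone:
    -- vanishing torsion.
    have h3 : koszul g X Y (FiberBundle.extend E w) x - koszul g Y X (FiberBundle.extend E w) x
        = 2 * g x (mlieBracket I X Y x) w := by
      have hs : (fun y ↦ g y (Y y) (X y)) = fun y ↦ g y (X y) (Y y) :=
        funext fun y ↦ hg.symm y _ _
      simp only [koszul, hs, mlieBracket_swap_apply (V := Y) (W := X), map_neg, neg_apply,
        FiberBundle.extend_apply_self]
      ring
    simp only [FiberBundle.extend_apply_self] at h1 h2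
    simp only [map_sub, sub_apply]
    linarith
  · intro x Y Z hY hZ u
    have h1 := hD (hext u) hY hZ
    have h2 := hD (hext u) hZ hY
    -- The part symmetric in the last two arguments is the derivative of g(Y, Z) alone:
    -- compatibility with the metric.
    have h3 : koszul g (FiberBundle.extend E u) Y Z x + koszul g (FiberBundle.extend E u) Z Y x
        = 2 * mvfderiv I (fun y ↦ g y (Y y) (Z y)) x u := by
      have hs : (fun y ↦ g y (Z y) (Y y)) = fun y ↦ g y (Y y) (Z y) :=
        funext fun y ↦ hg.symm y _ _
      simp only [koszul, hs, mlieBracket_swap_apply (V := Z) (W := Y), map_neg, neg_apply,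
        FiberBundle.extend_apply_self]
      ring
    simp only [FiberBundle.extend_apply_self] at h1 h2
    rw [hg.symm x (Y x)]
    change _ = g x (D Y x u) (Z x) + g x (D Z x u) (Y x)
    linarith

end Existence

end Koszul

/-! ### Derivatives along smooth fields -/

section VectorValued

variable {E : Type*} [NormedAddCommGroup E] [NormedSpace ℝ E]
  {H : Type*} [TopologicalSpace H] {I : ModelWithCorners ℝ E H}
  {M : Type*} [TopologicalSpace M] [ChartedSpace H M] [IsManifold I ∞ M]
  {F : Type*} [NormedAddCommGroup F] [NormedSpace ℝ F]

/-- The derivative of a smooth function along a smooth vector field is smooth. -/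
lemma ContMDiffAt.mvfderiv_apply {f : M → F} {x : M} (hf : ContMDiffAt I 𝓘(ℝ, F) ∞ f x)
    {X : Π x : M, TangentSpace I x}
    (hX : ContMDiffAt I I.tangent ∞ (fun y ↦ (⟨y, X y⟩ : TangentBundle I M)) x) :
    ContMDiffAt I 𝓘(ℝ, F) ∞ (fun y ↦ mvfderiv I f y (X y)) x := by
  have h := ContMDiffAt.clm_apply_of_inCoordinates (IM := I) (IB₁ := I) (IB₂ := 𝓘(ℝ, F)) (n := ∞)
    (F₁ := E) (F₂ := F) (E₁ := TangentSpace I) (E₂ := TangentSpace 𝓘(ℝ, F)) (b₁ := id) (b₂ := f)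
    (ϕ := fun y ↦ mfderiv I 𝓘(ℝ, F) f y) (v := X)
    (hf.mfderiv_const (m := ∞) le_rfl) hX hf
  exact (contMDiff_snd_tangentBundle_modelSpace F 𝓘(ℝ, F)).contMDiffAt.comp x h

end VectorValued

/-! ### Arc length and the unit tangent field of the curve -/

namespace OpenCurve

variable {m : ℕ} (β : OpenCurve m)

/-- The speed `‖β'‖`. -/
def speed (t : ℝ) : ℝ := ‖deriv β.toFun t‖

lemma contDiffOn_speed : ContDiffOn ℝ ∞ β.speed β.dom :=
  ((contDiffOn_infty_iff_deriv_of_isOpen β.isOpen_dom).1 β.smooth).2.norm ℝ β.regular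

lemma speed_pos {t : ℝ} (ht : t ∈ β.dom) : 0 < β.speed t := norm_pos_iff.2 (β.regular t ht)

/-- An arc length parameter of `β`. -/
def arcLength (t : ℝ) : ℝ := ∫ r in β.nonempty_dom.some..t, β.speed r

lemma hasDerivAt_arcLength {t : ℝ} (ht : t ∈ β.dom) : HasDerivAt β.arcLength (β.speed t) t := by
  have hc := β.contDiffOn_speed.continuousOn
  refine intervalIntegral.integral_hasDerivAt_right ?_ ?_
    (hc.continuousAt (β.isOpen_dom.mem_nhds ht))
  -- As the domain is an interval, the path of integration stays where the speed is continuous.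
  · exact (hc.mono (β.ordConnected_dom.uIcc_subset β.nonempty_dom.some_mem ht)).intervalIntegrable
  · exact hc.stronglyMeasurableAtFilter β.isOpen_dom t ht

lemma contDiffOn_arcLength : ContDiffOn ℝ ∞ β.arcLength β.dom := by
  rw [contDiffOn_infty_iff_deriv_of_isOpen β.isOpen_dom]
  exact ⟨fun t ht ↦ (β.hasDerivAt_arcLength ht).differentiableAt.differentiableWithinAt,
    β.contDiffOn_speed.congr fun t ht ↦ (β.hasDerivAt_arcLength ht).deriv⟩

lemma extChartAt_eq_param (c : β.Trace) : (extChartAt 𝓘(ℝ, ℝ) c : β.Trace → ℝ) = β.param := by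
  ext d
  rw [extChartAt_coe]
  rfl

lemma contMDiff_param : ContMDiff 𝓘(ℝ, ℝ) 𝓘(ℝ, ℝ) ∞ β.param := by
  intro c
  rw [← β.extChartAt_eq_param c]
  exact contMDiffAt_extChartAt

lemma mvfderiv_param (c : β.Trace) (v : TangentSpace 𝓘(ℝ, ℝ) c) :
    mvfderiv 𝓘(ℝ, ℝ) β.param c v = v := by
  have h : mfderiv 𝓘(ℝ, ℝ) 𝓘(ℝ, ℝ) (extChartAt 𝓘(ℝ, ℝ) c) c = ContinuousLinearMap.id ℝ _ :=
    mfderiv_extChartAt_self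
  rw [β.extChartAt_eq_param c] at h
  exact DFunLike.congr_fun h v

lemma contMDiff_comp_param {f : ℝ → ℝ} (hf : ContDiffOn ℝ ∞ f β.dom) :
    ContMDiff 𝓘(ℝ, ℝ) 𝓘(ℝ, ℝ) ∞ (f ∘ β.param) := fun c ↦
  ((hf.contDiffAt (β.isOpen_dom.mem_nhds (β.param_mem c))).contMDiffAt).comp c
    (β.contMDiff_param c)

/-- The coordinate h along T is the differential of a smooth function. Exactness later yields both
the smoothness of h and its behaviour on brackets. -/
lemma mvfderiv_arcLength_param (c : β.Trace) :
    mvfderiv 𝓘(ℝ, ℝ) (β.arcLength ∘ β.param) c = β.coord c := by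
  refine ContinuousLinearMap.ext fun v ↦ ?_
  have h := β.hasDerivAt_arcLength (β.param_mem c)
  rw [mvfderiv_comp_apply c h.differentiableAt.mdifferentiableAt
    ((β.contMDiff_param c).mdifferentiableAt (by simp))]
  have h1 : mvfderiv 𝓘(ℝ, ℝ) β.arcLength (β.param c) (1 : ℝ) = β.speed (β.param c) := by
    rw [← h.deriv]
    change mfderiv 𝓘(ℝ, ℝ) 𝓘(ℝ, ℝ) β.arcLength (β.param c) (1 : ℝ) = _
    rw [mfderiv_eq_fderiv]
    rfl
  let w : ℝ := v
  have h2 : mfderiv 𝓘(ℝ, ℝ) 𝓘(ℝ, ℝ) β.param c v = w • (1 : ℝ) :=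
    (β.mvfderiv_param c v).trans (mul_one w).symm
  rw [h2]
  refine (map_smul (mvfderiv 𝓘(ℝ, ℝ) β.arcLength (β.param c)) w (1 : ℝ)).trans ?_
  refine (congrArg (w • ·) h1).trans ?_
  exact mul_comm _ _

/-- In the single global chart, T has the coefficient 1/‖β'‖, smooth because β is regular. -/
lemma isSmoothField_unitTangent : IsSmoothField β.unitTangent := by
  intro c
  rw [contMDiffAt_section]
  have h : ContMDiff 𝓘(ℝ, ℝ) 𝓘(ℝ, ℝ) ∞ ((fun t ↦ (β.speed t)⁻¹) ∘ β.param) :=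
    β.contMDiff_comp_param (β.contDiffOn_speed.inv fun t ht ↦ (β.speed_pos ht).ne')
  refine (h c).congr_of_eventuallyEq (Filter.Eventually.of_forall fun d ↦ ?_)
  have hd : d ∈ (chartAt ℝ c).source := by
    rw [show (chartAt ℝ c).source = _ from rfl]
    trivial
  have h1 := DFunLike.congr_fun
    (TangentBundle.continuousLinearMapAt_trivializationAt (I := 𝓘(ℝ, ℝ)) hd) (β.unitTangent d)
  have hd' : d ∈ (trivializationAt ℝ (TangentSpace 𝓘(ℝ, ℝ)) c).baseSet := hd
  rw [(trivializationAt ℝ (TangentSpace 𝓘(ℝ, ℝ)) c).continuousLinearMapAt_apply_of_mem ℝ hd',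
    β.extChartAt_eq_param c] at h1
  exact h1.trans (β.mvfderiv_param d _)

end OpenCurve

/-! ### Horizontal lifts and the structure tensors on the product -/

section ProductGeometry

open VectorField

variable {n m : ℕ} {M₁ : Type*} [TopologicalSpace M₁]
  [ChartedSpace (EuclideanSpace ℝ (Fin (2 * n))) M₁]
  {β : OpenCurve m} {α : ℝ}
  {J : Π x : M₁, TangentSpace (𝓡 (2 * n)) x →L[ℝ] TangentSpace (𝓡 (2 * n)) x}
  {g₁ : Π x : M₁, TangentSpace (𝓡 (2 * n)) x →L[ℝ] TangentSpace (𝓡 (2 * n)) x →L[ℝ] ℝ}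
  {ω₁ : Π x : M₁, TangentSpace (𝓡 (2 * n)) x →L[ℝ] ℝ}

/-- The coordinate `h` of a tangent vector `(X₁, h T)`. -/
def heightForm (β : OpenCurve m) (p : M₁ × β.Trace) : TangentSpace (prodModel n) p →L[ℝ] ℝ :=
  β.coord p.2 ∘L tangentSnd β p

/-- The lift `(X₁, -α ω₁(X₁) T)` of `X₁` to the kernel of `η̄`. -/
def horizontalLift (β : OpenCurve m) (α : ℝ)
    (ω₁ : Π x : M₁, TangentSpace (𝓡 (2 * n)) x →L[ℝ] ℝ) (p : M₁ × β.Trace)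
    (v : TangentSpace (𝓡 (2 * n)) p.1) : TangentSpace (prodModel n) p :=
  tangentPair β p v (-(α * ω₁ p.1 v))

@[simp] lemma tangentFst_tangentPair (p : M₁ × β.Trace) (v : TangentSpace (𝓡 (2 * n)) p.1) (h : ℝ) :
    tangentFst β p (tangentPair β p v h) = v := rfl

@[simp] lemma heightForm_tangentPair (p : M₁ × β.Trace) (v : TangentSpace (𝓡 (2 * n)) p.1) (h : ℝ) :
    heightForm β p (tangentPair β p v h) = h := by
  change β.coord p.2 (h • β.unitTangent p.2) = h
  rw [map_smul, β.coord_unitTangent, smul_eq_mul, mul_one]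

lemma tangentPair_fst_height (p : M₁ × β.Trace) (u : TangentSpace (prodModel n) p) :
    tangentPair β p (tangentFst β p u) (heightForm β p u) = u :=
  Prod.ext rfl (β.coord_smul_unitTangent p.2 _)

lemma etaBar_apply (p : M₁ × β.Trace) (u : TangentSpace (prodModel n) p) :
    etaBar β α ω₁ p u = α * ω₁ p.1 (tangentFst β p u) + heightForm β p u := rfl

/-- The base component and η̄ determine a vector. In these coordinates φ̄, ξ̄, g and lifts have
simple expressions, so later vector identities are checked in them. -/
lemma tangent_ext {p : M₁ × β.Trace} {u v : TangentSpace (prodModel n) p}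
    (h₁ : tangentFst β p u = tangentFst β p v) (h₂ : etaBar β α ω₁ p u = etaBar β α ω₁ p v) :
    u = v := by
  rw [etaBar_apply, etaBar_apply, h₁, add_right_inj] at h₂
  rw [← tangentPair_fst_height p u, ← tangentPair_fst_height p v, h₁, h₂]

@[simp] lemma tangentFst_horizontalLift (p : M₁ × β.Trace) (v : TangentSpace (𝓡 (2 * n)) p.1) :
    tangentFst β p (horizontalLift β α ω₁ p v) = v := rfl

@[simp] lemma etaBar_horizontalLift (p : M₁ × β.Trace) (v : TangentSpace (𝓡 (2 * n)) p.1) :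
    etaBar β α ω₁ p (horizontalLift β α ω₁ p v) = 0 := by
  rw [etaBar_apply, horizontalLift, heightForm_tangentPair, tangentFst_tangentPair]
  ring

@[simp] lemma tangentFst_xiBar (p : M₁ × β.Trace) :
    tangentFst (n := n) β p (xiBar β p) = 0 := rfl

@[simp] lemma etaBar_xiBar (p : M₁ × β.Trace) : etaBar β α ω₁ p (xiBar β p) = 1 := by
  rw [etaBar_apply, tangentFst_xiBar, xiBar, heightForm_tangentPair, map_zero]
  ring

lemma horizontalLift_add_etaBar_smul (p : M₁ × β.Trace) (u : TangentSpace (prodModel n) p) :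
    horizontalLift β α ω₁ p (tangentFst β p u) + etaBar β α ω₁ p u • xiBar β p = u := by
  apply tangent_ext (α := α) (ω₁ := ω₁)
  · simp
  · simp

lemma phiBar_apply (p : M₁ × β.Trace) (u : TangentSpace (prodModel n) p) :
    phiBar β α J ω₁ p u = horizontalLift β α ω₁ p (J p.1 (tangentFst β p u)) := by
  refine Prod.ext rfl ?_
  change (-α * ω₁ p.1 (J p.1 (tangentFst β p u))) • β.unitTangent p.2 =
    (-(α * ω₁ p.1 (J p.1 (tangentFst β p u)))) • β.unitTangent p.2
  rw [neg_mul]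

@[simp] lemma tangentFst_phiBar (p : M₁ × β.Trace) (u : TangentSpace (prodModel n) p) :
    tangentFst β p (phiBar β α J ω₁ p u) = J p.1 (tangentFst β p u) := rfl

@[simp] lemma etaBar_phiBar (p : M₁ × β.Trace) (u : TangentSpace (prodModel n) p) :
    etaBar β α ω₁ p (phiBar β α J ω₁ p u) = 0 := by
  rw [phiBar_apply, etaBar_horizontalLift]

lemma gBar_apply (p : M₁ × β.Trace) (u v : TangentSpace (prodModel n) p) :
    gBar β α g₁ ω₁ p u v = g₁ p.1 (tangentFst β p u) (tangentFst β p v)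
      + etaBar β α ω₁ p u * etaBar β α ω₁ p v := rfl

/-- The field of horizontal lifts of a vector field on the base. -/
abbrev liftField (β : OpenCurve m) (α : ℝ) (ω₁ : Π x : M₁, TangentSpace (𝓡 (2 * n)) x →L[ℝ] ℝ)
    (X : Π x : M₁, TangentSpace (𝓡 (2 * n)) x) :
    Π p : M₁ × β.Trace, TangentSpace (prodModel n) p :=
  fun p ↦ horizontalLift β α ω₁ p (X p.1)

lemma gBar_horizontalLift_right (p : M₁ × β.Trace) (u : TangentSpace (prodModel n) p)
    (v : TangentSpace (𝓡 (2 * n)) p.1) :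
    gBar β α g₁ ω₁ p u (horizontalLift β α ω₁ p v) = g₁ p.1 (tangentFst β p u) v := by
  rw [gBar_apply, etaBar_horizontalLift, tangentFst_horizontalLift, mul_zero, add_zero]

lemma gBar_xiBar_right (p : M₁ × β.Trace) (u : TangentSpace (prodModel n) p) :
    gBar β α g₁ ω₁ p u (xiBar β p) = etaBar β α ω₁ p u := by
  rw [gBar_apply, etaBar_xiBar, tangentFst_xiBar, map_zero, zero_add, mul_one]

lemma phiBar_liftField (Y : Π x : M₁, TangentSpace (𝓡 (2 * n)) x) :
    (fun q : M₁ × β.Trace ↦ phiBar β α J ω₁ q (liftField β α ω₁ Y q)) =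
      liftField β α ω₁ (fun x ↦ J x (Y x)) := by
  ext1 q
  rw [phiBar_apply, tangentFst_horizontalLift]

lemma phiBar_xiBar (q : M₁ × β.Trace) : phiBar β α J ω₁ q (xiBar β q) = 0 := by
  apply tangent_ext (α := α) (ω₁ := ω₁) <;> simp

section Smoothness

variable [IsManifold (𝓡 (2 * n)) ∞ M₁]

lemma contMDiffAt_tangentFst {X : Π q : M₁ × β.Trace, TangentSpace (prodModel n) q}
    {p : M₁ × β.Trace}
    (hX : ContMDiffAt (prodModel n) (prodModel n).tangent ∞
      (fun q ↦ (⟨q, X q⟩ : TangentBundle (prodModel n) (M₁ × β.Trace))) p) :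
    ContMDiffAt (prodModel n) (𝓡 (2 * n)).tangent ∞
      (fun q ↦ (⟨q.1, tangentFst β q (X q)⟩ : TangentBundle (𝓡 (2 * n)) M₁)) p :=
  contMDiffAt_fst.comp p ((contMDiff_equivTangentBundleProd (n := ∞) (I := 𝓡 (2 * n))
    (I' := 𝓘(ℝ, ℝ)) (M := M₁) (M' := β.Trace)).contMDiffAt.comp p hX)

lemma contMDiffAt_tangentPair {X : Π q : M₁ × β.Trace, TangentSpace (𝓡 (2 * n)) q.1}
    {h : M₁ × β.Trace → ℝ} {p : M₁ × β.Trace}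
    (hX : ContMDiffAt (prodModel n) (𝓡 (2 * n)).tangent ∞
      (fun q ↦ (⟨q.1, X q⟩ : TangentBundle (𝓡 (2 * n)) M₁)) p)
    (hh : ContMDiffAt (prodModel n) 𝓘(ℝ, ℝ) ∞ h p) :
    ContMDiffAt (prodModel n) (prodModel n).tangent ∞
      (fun q ↦ (⟨q, tangentPair β q (X q) (h q)⟩ : TangentBundle (prodModel n) (M₁ × β.Trace)))
      p := by
  have hT : ContMDiffAt (prodModel n) 𝓘(ℝ, ℝ).tangent ∞
      (fun q : M₁ × β.Trace ↦ (⟨q.2, h q • β.unitTangent q.2⟩ : TangentBundle 𝓘(ℝ, ℝ) β.Trace))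
      p := by
    have hT₀ := (β.isSmoothField_unitTangent p.2).comp p
      (contMDiffAt_snd (I := 𝓡 (2 * n)) (M := M₁))
    rw [contMDiffAt_totalSpace] at hT₀ ⊢
    refine ⟨hT₀.1, (hh.smul hT₀.2).congr_of_eventuallyEq ?_⟩
    have hb : ∀ᶠ q : M₁ × β.Trace in 𝓝 p,
        q.2 ∈ (trivializationAt ℝ (TangentSpace 𝓘(ℝ, ℝ)) p.2).baseSet :=
      continuous_snd.continuousAt.eventually_mem
        ((trivializationAt ℝ (TangentSpace 𝓘(ℝ, ℝ)) p.2).open_baseSet.mem_nhds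
          (FiberBundle.mem_baseSet_trivializationAt' p.2))
    filter_upwards [hb] with q hq
    exact ((trivializationAt ℝ (TangentSpace 𝓘(ℝ, ℝ)) p.2).linear ℝ hq).map_smul _ _
  exact (contMDiff_equivTangentBundleProd_symm (n := ∞) (I := 𝓡 (2 * n))
    (I' := 𝓘(ℝ, ℝ)) (M := M₁) (M' := β.Trace)).contMDiffAt.comp p (hX.prodMk hT)

end Smoothness

/-- The arc length of `β`, as a function on the product. -/
def height (β : OpenCurve m) : M₁ × β.Trace → ℝ := (β.arcLength ∘ β.param) ∘ Prod.snd

lemma contMDiff_height : ContMDiff (prodModel n) 𝓘(ℝ, ℝ) ∞ (height (M₁ := M₁) β) :=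
  (β.contMDiff_comp_param β.contDiffOn_arcLength).comp contMDiff_snd

lemma mvfderiv_height (p : M₁ × β.Trace) :
    mvfderiv (prodModel n) (height (M₁ := M₁) β) p = heightForm β p := by
  refine ContinuousLinearMap.ext fun u ↦ ?_
  rw [height, mvfderiv_comp_apply p
    ((β.contMDiff_comp_param β.contDiffOn_arcLength).mdifferentiable (by simp) _)
    mdifferentiableAt_snd, β.mvfderiv_arcLength_param, mfderiv_snd]
  rfl

lemma mvfderiv_comp_fst {F : Type*} [NormedAddCommGroup F] [NormedSpace ℝ F] {f : M₁ → F}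
    {p : M₁ × β.Trace} (hf : MDifferentiableAt (𝓡 (2 * n)) 𝓘(ℝ, F) f p.1)
    (u : TangentSpace (prodModel n) p) :
    mvfderiv (prodModel n) (fun q : M₁ × β.Trace ↦ f q.1) p u =
      mvfderiv (𝓡 (2 * n)) f p.1 (tangentFst β p u) := by
  have := mfderiv_comp_apply (f := Prod.fst) (g := f) p hf mdifferentiableAt_fst u
  rw [mfderiv_fst] at this
  exact this

section Fields

variable [IsManifold (𝓡 (2 * n)) ∞ M₁]

/-- The form is the differential of the arc length, so its value on a smooth field is a derivative
of a smooth function. -/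
lemma contMDiffAt_heightForm {X : Π q : M₁ × β.Trace, TangentSpace (prodModel n) q}
    {p : M₁ × β.Trace}
    (hX : ContMDiffAt (prodModel n) (prodModel n).tangent ∞
      (fun q ↦ (⟨q, X q⟩ : TangentBundle (prodModel n) (M₁ × β.Trace))) p) :
    ContMDiffAt (prodModel n) 𝓘(ℝ, ℝ) ∞ (fun q ↦ heightForm β q (X q)) p := by
  simp only [← mvfderiv_height]
  exact (contMDiff_height p).mvfderiv_apply hX

lemma contMDiffAt_oneForm_comp (hω₁ : IsSmoothOneForm ω₁)
    {X : Π q : M₁ × β.Trace, TangentSpace (𝓡 (2 * n)) q.1} {p : M₁ × β.Trace}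
    (hX : ContMDiffAt (prodModel n) (𝓡 (2 * n)).tangent ∞
      (fun q ↦ (⟨q.1, X q⟩ : TangentBundle (𝓡 (2 * n)) M₁)) p) :
    ContMDiffAt (prodModel n) 𝓘(ℝ, ℝ) ∞ (fun q ↦ ω₁ q.1 (X q)) p := by
  have h := ContMDiffAt.clm_bundle_apply (F₁ := EuclideanSpace ℝ (Fin (2 * n))) (F₂ := ℝ)
    (E₂ := Bundle.Trivial M₁ ℝ) (b := Prod.fst) ((hω₁ p.1).comp p contMDiffAt_fst) hX
  exact (contMDiffAt_totalSpace.1 h).2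

lemma contMDiffAt_etaBar_apply (hω₁ : IsSmoothOneForm ω₁)
    {X : Π q : M₁ × β.Trace, TangentSpace (prodModel n) q} {p : M₁ × β.Trace}
    (hX : ContMDiffAt (prodModel n) (prodModel n).tangent ∞
      (fun q ↦ (⟨q, X q⟩ : TangentBundle (prodModel n) (M₁ × β.Trace))) p) :
    ContMDiffAt (prodModel n) 𝓘(ℝ, ℝ) ∞ (fun q ↦ etaBar β α ω₁ q (X q)) p :=
  (contMDiffAt_const.mul (contMDiffAt_oneForm_comp hω₁ (contMDiffAt_tangentFst hX))).add
    (contMDiffAt_heightForm hX)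

lemma contMDiffAt_horizontalLift (hω₁ : IsSmoothOneForm ω₁)
    {X : Π q : M₁ × β.Trace, TangentSpace (𝓡 (2 * n)) q.1} {p : M₁ × β.Trace}
    (hX : ContMDiffAt (prodModel n) (𝓡 (2 * n)).tangent ∞
      (fun q ↦ (⟨q.1, X q⟩ : TangentBundle (𝓡 (2 * n)) M₁)) p) :
    ContMDiffAt (prodModel n) (prodModel n).tangent ∞
      (fun q ↦ (⟨q, horizontalLift β α ω₁ q (X q)⟩ :
        TangentBundle (prodModel n) (M₁ × β.Trace))) p :=
  contMDiffAt_tangentPair hX (contMDiffAt_const.mul (contMDiffAt_oneForm_comp hω₁ hX)).neg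

lemma isSmoothField_horizontalLift (hω₁ : IsSmoothOneForm ω₁)
    {X : Π x : M₁, TangentSpace (𝓡 (2 * n)) x} (hX : IsSmoothField X) :
    IsSmoothField (fun q : M₁ × β.Trace ↦ horizontalLift β α ω₁ q (X q.1)) := fun p ↦
  contMDiffAt_horizontalLift hω₁ ((hX p.1).comp p contMDiffAt_fst)

lemma isSmoothField_xiBar : IsSmoothField (xiBar (n := n) (M₁ := M₁) β) := fun p ↦
  contMDiffAt_tangentPair
    ((contMDiff_zeroSection ℝ (TangentSpace (𝓡 (2 * n)) : M₁ → Type _) p.1).comp p contMDiffAt_fst)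
    contMDiffAt_const

lemma isSmoothOneForm_etaBar (hω₁ : IsSmoothOneForm ω₁) :
    IsSmoothOneForm (etaBar (n := n) (M₁ := M₁) β α ω₁) :=
  fun _ ↦ contMDiffAt_hom_of_apply (V := Bundle.Trivial (M₁ × β.Trace) ℝ) fun _ hX ↦
    contMDiffAt_totalSpace.2 ⟨contMDiffAt_id, contMDiffAt_etaBar_apply hω₁ hX⟩

lemma isSmoothEndField_phiBar (hJ : IsSmoothEndField J) (hω₁ : IsSmoothOneForm ω₁) :
    IsSmoothEndField (phiBar (n := n) (M₁ := M₁) β α J ω₁) := by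
  refine fun p ↦ contMDiffAt_hom_of_apply (V := TangentSpace (prodModel n)) fun X hX ↦ ?_
  simp only [phiBar_apply]
  exact contMDiffAt_horizontalLift hω₁ (ContMDiffAt.clm_bundle_apply
    (F₁ := EuclideanSpace ℝ (Fin (2 * n))) (F₂ := EuclideanSpace ℝ (Fin (2 * n)))
    (b := Prod.fst) ((hJ p.1).comp p contMDiffAt_fst) (contMDiffAt_tangentFst hX))

lemma isRiemannianMetric_gBar (hg₁ : IsRiemannianMetric g₁) (hω₁ : IsSmoothOneForm ω₁) :
    IsRiemannianMetric (gBar (n := n) (M₁ := M₁) β α g₁ ω₁) where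
  symm p u v := by
    rw [gBar_apply, gBar_apply, hg₁.symm, mul_comm (etaBar β α ω₁ p u)]
  pos p u hu := by
    rw [gBar_apply]
    by_cases h : tangentFst β p u = 0
    · have hη : etaBar β α ω₁ p u ≠ 0 := fun hη ↦ hu <| by
        apply tangent_ext (α := α) (ω₁ := ω₁) <;> simp [h, hη]
      rw [h, map_zero, zero_add]
      exact mul_self_pos.2 hη
    · exact add_pos_of_pos_of_nonneg (hg₁.pos _ _ h) (mul_self_nonneg _)
  smooth := by
    refine fun p ↦ contMDiffAt_hom_of_apply
      (V := fun q : M₁ × β.Trace ↦ TangentSpace (prodModel n) q →L[ℝ] ℝ) fun X hX ↦ ?_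
    refine contMDiffAt_hom_of_apply (V := Bundle.Trivial (M₁ × β.Trace) ℝ) fun Y hY ↦ ?_
    refine contMDiffAt_totalSpace.2 ⟨contMDiffAt_id, ?_⟩
    have h := ContMDiffAt.clm_bundle_apply₂ (F₁ := EuclideanSpace ℝ (Fin (2 * n)))
      (F₂ := EuclideanSpace ℝ (Fin (2 * n))) (F₃ := ℝ) (E₃ := Bundle.Trivial M₁ ℝ) (b := Prod.fst)
      ((hg₁.smooth p.1).comp p contMDiffAt_fst) (contMDiffAt_tangentFst hX)
      (contMDiffAt_tangentFst hY)
    exact (contMDiffAt_totalSpace.1 h).2.add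
      ((contMDiffAt_etaBar_apply hω₁ hX).mul (contMDiffAt_etaBar_apply hω₁ hY))

end Fields

end ProductGeometry

/-! ### Almost contact metric axioms and brackets of lifts -/

section Brackets

open VectorField

variable {n m : ℕ} {M₁ : Type*} [TopologicalSpace M₁]
  [ChartedSpace (EuclideanSpace ℝ (Fin (2 * n))) M₁] [IsManifold (𝓡 (2 * n)) ∞ M₁]
  {β : OpenCurve m} {α : ℝ}
  {J : Π x : M₁, TangentSpace (𝓡 (2 * n)) x →L[ℝ] TangentSpace (𝓡 (2 * n)) x}
  {g₁ : Π x : M₁, TangentSpace (𝓡 (2 * n)) x →L[ℝ] TangentSpace (𝓡 (2 * n)) x →L[ℝ] ℝ}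
  {ω₁ : Π x : M₁, TangentSpace (𝓡 (2 * n)) x →L[ℝ] ℝ}

lemma isAlmostContactMetric_product (hJ : IsAlmostHermitian J g₁) (hω₁ : IsSmoothOneForm ω₁) :
    IsAlmostContactMetric (M := M₁ × β.Trace)
      (phiBar β α J ω₁) (xiBar β) (etaBar β α ω₁) (gBar β α g₁ ω₁) where
  smooth_phi := isSmoothEndField_phiBar hJ.smooth hω₁
  smooth_xi := isSmoothField_xiBar
  smooth_eta := isSmoothOneForm_etaBar hω₁
  metric := isRiemannianMetric_gBar hJ.metric hω₁
  phi_sq p u := by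
    apply tangent_ext (α := α) (ω₁ := ω₁) <;> simp [hJ.sq]
  eta_xi p := etaBar_xiBar p
  compat p u v := by
    rw [gBar_apply, gBar_apply]
    simp [hJ.compat]

lemma Filter.EventuallyEq.mvfderiv_eq {E : Type*} [NormedAddCommGroup E] [NormedSpace ℝ E]
    {H : Type*} [TopologicalSpace H] {I : ModelWithCorners ℝ E H}
    {M : Type*} [TopologicalSpace M] [ChartedSpace H M]
    {F : Type*} [NormedAddCommGroup F] [NormedSpace ℝ F] {f f' : M → F} {x : M}
    (h : f =ᶠ[𝓝 x] f') : mvfderiv I f x = mvfderiv I f' x := by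
  have h1 : mfderiv I 𝓘(ℝ, F) f x = mfderiv I 𝓘(ℝ, F) f' x := h.mfderiv_eq
  exact h1

/-- The bracket of projectable vector fields projects to the bracket of their projections. -/
lemma tangentFst_mlieBracket {V W : Π p : M₁ × β.Trace, TangentSpace (prodModel n) p}
    {V' W' : Π x : M₁, TangentSpace (𝓡 (2 * n)) x} (hV : IsSmoothField V) (hW : IsSmoothField W)
    (hV' : IsSmoothField V') (hW' : IsSmoothField W')
    (hVV' : ∀ p, tangentFst β p (V p) = V' p.1) (hWW' : ∀ p, tangentFst β p (W p) = W' p.1)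
    (p : M₁ × β.Trace) :
    tangentFst β p (mlieBracket (prodModel n) V W p) = mlieBracket (𝓡 (2 * n)) V' W' p.1 := by
  -- The derivative of this chart at its base point is the identity, so df of a vector at p.1 is the
  -- vector itself.
  let f : M₁ → EuclideanSpace ℝ (Fin (2 * n)) := extChartAt (𝓡 (2 * n)) p.1
  have hf : ContMDiffAt (𝓡 (2 * n)) 𝓘(ℝ, EuclideanSpace ℝ (Fin (2 * n))) ∞ f p.1 :=
    contMDiffAt_extChartAt
  have hF : ContMDiffAt (prodModel n) 𝓘(ℝ, EuclideanSpace ℝ (Fin (2 * n))) ∞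
      (fun q : M₁ × β.Trace ↦ f q.1) p := hf.comp p contMDiffAt_fst
  have hid (v : TangentSpace (𝓡 (2 * n)) p.1) : mvfderiv (𝓡 (2 * n)) f p.1 v = v := by
    have h : mfderiv (𝓡 (2 * n)) 𝓘(ℝ, EuclideanSpace ℝ (Fin (2 * n))) f p.1 =
        ContinuousLinearMap.id ℝ _ := mfderiv_extChartAt_self
    exact DFunLike.congr_fun h v
  have hev : ∀ᶠ q : M₁ × β.Trace in 𝓝 p,
      MDifferentiableAt (𝓡 (2 * n)) 𝓘(ℝ, EuclideanSpace ℝ (Fin (2 * n))) f q.1 := by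
    have h1 : ∀ᶠ x in 𝓝 p.1,
        MDifferentiableAt (𝓡 (2 * n)) 𝓘(ℝ, EuclideanSpace ℝ (Fin (2 * n))) f x :=
      ((contMDiffAt_iff_contMDiffAt_nhds (n := 1) (by simp)).1 (hf.of_le (by simp))).mono
        fun y hy ↦ hy.mdifferentiableAt (by simp)
    exact continuous_fst.continuousAt.eventually h1
  -- Iterated derivatives of a function pulled back from M₁ along projectable fields are again
  -- pulled back.
  have key {X Y : Π p : M₁ × β.Trace, TangentSpace (prodModel n) p}
      {X' Y' : Π x : M₁, TangentSpace (𝓡 (2 * n)) x} (hX' : IsSmoothField X')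
      (hXX' : ∀ p, tangentFst β p (X p) = X' p.1) (hYY' : ∀ p, tangentFst β p (Y p) = Y' p.1) :
      mvfderiv (prodModel n)
        (fun q ↦ mvfderiv (prodModel n) (fun q : M₁ × β.Trace ↦ f q.1) q (X q)) p (Y p) =
      mvfderiv (𝓡 (2 * n)) (fun x ↦ mvfderiv (𝓡 (2 * n)) f x (X' x)) p.1 (Y' p.1) := by
    rw [← hYY', ← mvfderiv_comp_fst (((hf.mvfderiv_apply (hX' p.1)).mdifferentiableAt (by simp)))]
    refine DFunLike.congr_fun (Filter.EventuallyEq.mvfderiv_eq ?_) _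
    filter_upwards [hev] with q hq
    rw [mvfderiv_comp_fst hq, hXX']
  have h1 := mvfderiv_mlieBracket (hF.of_le ENat.LEInfty.out) (hV.mdifferentiableAt p)
    (hW.mdifferentiableAt p) ((hF.mvfderiv_apply (hV p)).mdifferentiableAt (by simp))
    ((hF.mvfderiv_apply (hW p)).mdifferentiableAt (by simp))
  have h2 := mvfderiv_mlieBracket (hf.of_le ENat.LEInfty.out) (hV'.mdifferentiableAt p.1)
    (hW'.mdifferentiableAt p.1) ((hf.mvfderiv_apply (hV' p.1)).mdifferentiableAt (by simp))
    ((hf.mvfderiv_apply (hW' p.1)).mdifferentiableAt (by simp))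
  rw [key hW' hWW' hVV', key hV' hVV' hWW', ← h2,
    mvfderiv_comp_fst (hf.mdifferentiableAt (by simp)), hid, hid] at h1
  exact h1

/-- The coordinate h is an exact form, hence closed. -/
lemma heightForm_mlieBracket {V W : Π p : M₁ × β.Trace, TangentSpace (prodModel n) p}
    (hV : IsSmoothField V) (hW : IsSmoothField W) (p : M₁ × β.Trace) :
    heightForm β p (mlieBracket (prodModel n) V W p) =
      mvfderiv (prodModel n) (fun q ↦ heightForm β q (W q)) p (V p)
        - mvfderiv (prodModel n) (fun q ↦ heightForm β q (V q)) p (W p) := by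
  have hh := contMDiff_height (n := n) (M₁ := M₁) (β := β) p
  have h := mvfderiv_mlieBracket (hh.of_le ENat.LEInfty.out) (hV.mdifferentiableAt p)
    (hW.mdifferentiableAt p) ((hh.mvfderiv_apply (hV p)).mdifferentiableAt (by simp))
    ((hh.mvfderiv_apply (hW p)).mdifferentiableAt (by simp))
  simpa only [mvfderiv_height] using h

variable {X Y Z : Π x : M₁, TangentSpace (𝓡 (2 * n)) x}

lemma IsSmoothOneForm.mdifferentiableAt_apply (hω₁ : IsSmoothOneForm ω₁) (hX : IsSmoothField X)
    (x : M₁) : MDifferentiableAt (𝓡 (2 * n)) 𝓘(ℝ, ℝ) (fun y ↦ ω₁ y (X y)) x := by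
  have h := ContMDiffAt.clm_bundle_apply (F₁ := EuclideanSpace ℝ (Fin (2 * n))) (F₂ := ℝ)
    (E₂ := Bundle.Trivial M₁ ℝ) (b := fun y : M₁ ↦ y) (hω₁ x) (hX x)
  exact (contMDiffAt_totalSpace.1 h).2.mdifferentiableAt (by simp)

lemma mvfderiv_heightForm_liftField (hω₁ : IsSmoothOneForm ω₁) (hX : IsSmoothField X)
    (p : M₁ × β.Trace) (u : TangentSpace (prodModel n) p) :
    mvfderiv (prodModel n) (fun q ↦ heightForm β q (liftField β α ω₁ X q)) p u =
      -(α * mvfderiv (𝓡 (2 * n)) (fun y ↦ ω₁ y (X y)) p.1 (tangentFst β p u)) := by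
  have hd := hω₁.mdifferentiableAt_apply hX p.1
  simp only [liftField, horizontalLift, heightForm_tangentPair]
  have hd' : MDifferentiableAt (𝓡 (2 * n)) 𝓘(ℝ, ℝ) (fun y ↦ -(α * ω₁ y (X y))) p.1 :=
    (hd.const_smul α).neg
  rw [mvfderiv_comp_fst hd', mvfderiv_fun_neg, mvfderiv_fun_mul mdifferentiableAt_const hd,
    mvfderiv_const]
  simp

/-- The projections X and 0 commute, and the height coefficients -α ω(X) and 1 are constant along β
and on M respectively. -/
lemma mlieBracket_liftField_xiBar (hω₁ : IsSmoothOneForm ω₁) (hX : IsSmoothField X)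
    (p : M₁ × β.Trace) :
    mlieBracket (prodModel n) (liftField β α ω₁ X) (xiBar β) p = 0 := by
  have hl := isSmoothField_horizontalLift (β := β) (α := α) hω₁ hX
  have h0 : tangentFst β p (mlieBracket (prodModel n) (liftField β α ω₁ X) (xiBar β) p) = 0 := by
    rw [tangentFst_mlieBracket (V' := X) (W' := 0) hl isSmoothField_xiBar hX
      (contMDiff_zeroSection ℝ (TangentSpace (𝓡 (2 * n)) : M₁ → Type _))
      (fun _ ↦ rfl) (fun _ ↦ rfl), mlieBracket_zero_right]
    rfl
  apply tangent_ext (α := α) (ω₁ := ω₁)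
  · rw [h0, map_zero]
  · rw [etaBar_apply, h0, heightForm_mlieBracket hl isSmoothField_xiBar,
      mvfderiv_heightForm_liftField hω₁ hX]
    simp [xiBar, mvfderiv_const]

lemma mlieBracket_xiBar_liftField (hω₁ : IsSmoothOneForm ω₁) (hX : IsSmoothField X)
    (p : M₁ × β.Trace) :
    mlieBracket (prodModel n) (xiBar β) (liftField β α ω₁ X) p = 0 := by
  rw [mlieBracket_swap_apply, mlieBracket_liftField_xiBar hω₁ hX, neg_zero]

lemma tangentFst_mlieBracket_liftField (hω₁ : IsSmoothOneForm ω₁) (hX : IsSmoothField X)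
    (hY : IsSmoothField Y) (p : M₁ × β.Trace) :
    tangentFst β p (mlieBracket (prodModel n) (liftField β α ω₁ X) (liftField β α ω₁ Y) p) =
      mlieBracket (𝓡 (2 * n)) X Y p.1 :=
  tangentFst_mlieBracket (isSmoothField_horizontalLift hω₁ hX)
    (isSmoothField_horizontalLift hω₁ hY) hX hY (fun _ ↦ rfl) (fun _ ↦ rfl) p

/-- This is the curvature of the horizontal distribution; the factor 2 comes from the normalisation
of dω. -/
lemma etaBar_mlieBracket_liftField (hω₁ : IsSmoothOneForm ω₁) (hX : IsSmoothField X)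
    (hY : IsSmoothField Y) (p : M₁ × β.Trace) :
    etaBar β α ω₁ p (mlieBracket (prodModel n) (liftField β α ω₁ X) (liftField β α ω₁ Y) p) =
      -(2 * α * dOneForm ω₁ X Y p.1) := by
  rw [etaBar_apply, tangentFst_mlieBracket_liftField hω₁ hX hY,
    heightForm_mlieBracket (isSmoothField_horizontalLift hω₁ hX)
      (isSmoothField_horizontalLift hω₁ hY), mvfderiv_heightForm_liftField hω₁ hX,
    mvfderiv_heightForm_liftField hω₁ hY, dOneForm]
  simp only [tangentFst_horizontalLift]
  ring

end Brackets

/-! ### The Levi-Civita connection on lifts and on ξ̄ -/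

section Connection

open VectorField

variable {n m : ℕ} {M₁ : Type*} [TopologicalSpace M₁]
  [ChartedSpace (EuclideanSpace ℝ (Fin (2 * n))) M₁] [IsManifold (𝓡 (2 * n)) ∞ M₁]
  {β : OpenCurve m} {α : ℝ}
  {J : Π x : M₁, TangentSpace (𝓡 (2 * n)) x →L[ℝ] TangentSpace (𝓡 (2 * n)) x}
  {g₁ : Π x : M₁, TangentSpace (𝓡 (2 * n)) x →L[ℝ] TangentSpace (𝓡 (2 * n)) x →L[ℝ] ℝ}
  {ω₁ : Π x : M₁, TangentSpace (𝓡 (2 * n)) x →L[ℝ] ℝ}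
  {X Y Z : Π x : M₁, TangentSpace (𝓡 (2 * n)) x}

variable {cov : CovariantDerivative (prodModel n) (EuclideanSpace ℝ (Fin (2 * n)) × ℝ)
    (TangentSpace (prodModel n) : M₁ × β.Trace → Type _)}
  {cov₁ : CovariantDerivative (𝓡 (2 * n)) (EuclideanSpace ℝ (Fin (2 * n)))
    (TangentSpace (𝓡 (2 * n)) : M₁ → Type _)}

lemma mvfderiv_gBar_liftField (hg₁ : IsRiemannianMetric g₁) (hX : IsSmoothField X)
    (hY : IsSmoothField Y) (p : M₁ × β.Trace) (u : TangentSpace (prodModel n) p) :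
    mvfderiv (prodModel n) (fun q ↦ gBar β α g₁ ω₁ q (liftField β α ω₁ X q)
      (liftField β α ω₁ Y q)) p u =
      mvfderiv (𝓡 (2 * n)) (fun x ↦ g₁ x (X x) (Y x)) p.1 (tangentFst β p u) := by
  simp only [liftField, gBar_horizontalLift_right, tangentFst_horizontalLift]
  exact mvfderiv_comp_fst
    (hg₁.mdifferentiableAt_apply (hX.mdifferentiableAt p.1) (hY.mdifferentiableAt p.1)) u

/-- Two tangent vectors are equal if they have the same `gBar`-products with horizontal lifts of
smooth fields and with `xiBar`. -/
lemma tangent_ext_gBar [T2Space M₁] (hg₁ : IsRiemannianMetric g₁) {p : M₁ × β.Trace}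
    {u v : TangentSpace (prodModel n) p}
    (h : ∀ Z : Π x : M₁, TangentSpace (𝓡 (2 * n)) x, IsSmoothField Z →
      gBar β α g₁ ω₁ p u (liftField β α ω₁ Z p) = gBar β α g₁ ω₁ p v (liftField β α ω₁ Z p))
    (hξ : gBar β α g₁ ω₁ p u (xiBar β p) = gBar β α g₁ ω₁ p v (xiBar β p)) : u = v := by
  apply tangent_ext (α := α) (ω₁ := ω₁)
  · refine hg₁.eq_of_forall_apply_eq fun w ↦ ?_
    obtain ⟨Z, hZ, rfl⟩ := exists_isSmoothField_apply_eq p.1 w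
    simpa only [liftField, gBar_horizontalLift_right] using h Z hZ
  · rwa [gBar_xiBar_right, gBar_xiBar_right] at hξ

lemma apply_apply_eq_neg (hJ : IsAlmostHermitian J g₁) (x : M₁) (u v : TangentSpace (𝓡 (2 * n)) x) :
    g₁ x (J x u) v = -g₁ x u (J x v) := by
  rw [← hJ.compat x u (J x v), hJ.sq, map_neg, neg_neg]

/-- `∇_{X^h} Y^h = (∇¹_X Y)^h - α g₁(X, JY) ξ̄`. -/
lemma cov_liftField_liftField [T2Space M₁] (hJ : IsAlmostHermitian J g₁)
    (hω₁ : IsSmoothOneForm ω₁)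
    (hdω₁ : ∀ X Y : Π x : M₁, TangentSpace (𝓡 (2 * n)) x, IsSmoothField X → IsSmoothField Y →
      ∀ x : M₁, dOneForm ω₁ X Y x = g₁ x (X x) (J x (Y x)))
    (hcov : IsLeviCivita (gBar β α g₁ ω₁) cov) (hcov₁ : IsLeviCivita g₁ cov₁)
    (hX : IsSmoothField X) (hY : IsSmoothField Y) (p : M₁ × β.Trace) :
    cov (liftField β α ω₁ Y) p (liftField β α ω₁ X p) =
      horizontalLift β α ω₁ p (cov₁ Y p.1 (X p.1))
        + (-(α * g₁ p.1 (X p.1) (J p.1 (Y p.1)))) • xiBar β p := by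
  have hg := isRiemannianMetric_gBar (β := β) (α := α) hJ.metric hω₁
  have lX := (isSmoothField_horizontalLift (β := β) (α := α) hω₁ hX).mdifferentiableAt p
  have lY := (isSmoothField_horizontalLift (β := β) (α := α) hω₁ hY).mdifferentiableAt p
  refine tangent_ext_gBar (α := α) (ω₁ := ω₁) hJ.metric (fun Z hZ ↦ ?_) ?_
  · have lZ := (isSmoothField_horizontalLift (β := β) (α := α) hω₁ hZ).mdifferentiableAt p
    have h1 : 2 * gBar β α g₁ ω₁ p (cov (liftField β α ω₁ Y) p (liftField β α ω₁ X p))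
        (liftField β α ω₁ Z p) = koszul (gBar β α g₁ ω₁) (liftField β α ω₁ X)
          (liftField β α ω₁ Y) (liftField β α ω₁ Z) p :=
      hcov.two_mul_apply_eq_koszul hg lX lY lZ
    have h2 := hcov₁.two_mul_apply_eq_koszul hJ.metric (hX.mdifferentiableAt p.1)
      (hY.mdifferentiableAt p.1) (hZ.mdifferentiableAt p.1)
    have h3 : koszul (gBar β α g₁ ω₁) (liftField β α ω₁ X) (liftField β α ω₁ Y)
        (liftField β α ω₁ Z) p = koszul g₁ X Y Z p.1 := by
      simp only [koszul, mvfderiv_gBar_liftField hJ.metric, hX, hY, hZ]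
      simp only [liftField, gBar_horizontalLift_right, tangentFst_horizontalLift]
      simp only [tangentFst_mlieBracket_liftField hω₁, hX, hY, hZ]
    rw [h3, ← h2] at h1
    generalize cov (liftField β α ω₁ Y) p (liftField β α ω₁ X p) = W at h1 ⊢
    rw [gBar_horizontalLift_right] at h1
    rw [gBar_horizontalLift_right, gBar_horizontalLift_right, map_add, map_smul,
      tangentFst_horizontalLift, tangentFst_xiBar, smul_zero, add_zero]
    linarith
  · have h1 : 2 * gBar β α g₁ ω₁ p (cov (liftField β α ω₁ Y) p (liftField β α ω₁ X p))
        (xiBar β p) = koszul (gBar β α g₁ ω₁) (liftField β α ω₁ X)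
          (liftField β α ω₁ Y) (xiBar β) p :=
      hcov.two_mul_apply_eq_koszul hg lX lY (isSmoothField_xiBar.mdifferentiableAt p)
    generalize cov (liftField β α ω₁ Y) p (liftField β α ω₁ X p) = W at h1 ⊢
    -- Only g([X^h, Y^h], ξ̄) survives, since g(X^h, Y^h) is constant along ξ̄ and ξ̄ commutes with
    -- lifts.
    simp only [koszul, mvfderiv_gBar_liftField hJ.metric, hX, hY, mlieBracket_liftField_xiBar hω₁,
      gBar_xiBar_right, etaBar_horizontalLift, mvfderiv_const, tangentFst_xiBar, map_zero,
      zero_apply, etaBar_mlieBracket_liftField hω₁, hdω₁ X Y hX hY] at h1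
    rw [gBar_xiBar_right, gBar_xiBar_right, map_add, map_smul, etaBar_horizontalLift, etaBar_xiBar,
      smul_eq_mul]
    linarith

/-- `∇_{X^h} ξ̄ = -α (JX)^h`. -/
lemma cov_xiBar_liftField [T2Space M₁] (hJ : IsAlmostHermitian J g₁) (hω₁ : IsSmoothOneForm ω₁)
    (hdω₁ : ∀ X Y : Π x : M₁, TangentSpace (𝓡 (2 * n)) x, IsSmoothField X → IsSmoothField Y →
      ∀ x : M₁, dOneForm ω₁ X Y x = g₁ x (X x) (J x (Y x)))
    (hcov : IsLeviCivita (gBar β α g₁ ω₁) cov) (hX : IsSmoothField X) (p : M₁ × β.Trace) :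
    cov (xiBar β) p (liftField β α ω₁ X p) =
      (-α) • horizontalLift β α ω₁ p (J p.1 (X p.1)) := by
  have hg := isRiemannianMetric_gBar (β := β) (α := α) hJ.metric hω₁
  have lX := (isSmoothField_horizontalLift (β := β) (α := α) hω₁ hX).mdifferentiableAt p
  have hξ := (isSmoothField_xiBar (n := n) (M₁ := M₁) (β := β)).mdifferentiableAt p
  refine tangent_ext_gBar (α := α) (ω₁ := ω₁) hJ.metric (fun Z hZ ↦ ?_) ?_
  · have lZ := (isSmoothField_horizontalLift (β := β) (α := α) hω₁ hZ).mdifferentiableAt p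
    have h1 := hcov.two_mul_apply_eq_koszul hg lX hξ lZ
    -- Only -g([X^h, Z^h], ξ̄) = 2α g₁(X, JZ) survives; skew-symmetry of J then moves J onto X.
    simp only [koszul, mvfderiv_gBar_liftField hJ.metric, hX, hZ, mlieBracket_liftField_xiBar hω₁,
      mlieBracket_xiBar_liftField hω₁, hg.symm _ (xiBar β _) (liftField β α ω₁ _ _),
      gBar_xiBar_right, etaBar_horizontalLift, mvfderiv_const, tangentFst_xiBar, map_zero,
      zero_apply, etaBar_mlieBracket_liftField hω₁, hdω₁ X Z hX hZ] at h1
    simp only [liftField, gBar_horizontalLift_right, map_smul, smul_apply,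
      tangentFst_horizontalLift, smul_eq_mul, apply_apply_eq_neg hJ] at h1 ⊢
    linarith
  · have h1 : 2 * gBar β α g₁ ω₁ p (cov (xiBar β) p (liftField β α ω₁ X p)) (xiBar β p) =
        koszul (gBar β α g₁ ω₁) (liftField β α ω₁ X) (xiBar β) (xiBar β) p :=
      hcov.two_mul_apply_eq_koszul hg lX hξ hξ
    generalize cov (xiBar β) p (liftField β α ω₁ X p) = W at h1 ⊢
    simp only [koszul, mlieBracket_liftField_xiBar hω₁ hX, mlieBracket_self,
      gBar_xiBar_right, etaBar_xiBar, etaBar_horizontalLift, mvfderiv_const, map_zero,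
      zero_apply, Pi.zero_apply] at h1
    rw [gBar_xiBar_right, gBar_xiBar_right, map_smul, etaBar_horizontalLift, smul_zero]
    linarith

/-- `∇_{ξ̄} X^h = -α (JX)^h`. -/
lemma cov_liftField_xiBar [T2Space M₁] (hJ : IsAlmostHermitian J g₁) (hω₁ : IsSmoothOneForm ω₁)
    (hdω₁ : ∀ X Y : Π x : M₁, TangentSpace (𝓡 (2 * n)) x, IsSmoothField X → IsSmoothField Y →
      ∀ x : M₁, dOneForm ω₁ X Y x = g₁ x (X x) (J x (Y x)))
    (hcov : IsLeviCivita (gBar β α g₁ ω₁) cov) (hX : IsSmoothField X) (p : M₁ × β.Trace) :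
    cov (liftField β α ω₁ X) p (xiBar β p) =
      (-α) • horizontalLift β α ω₁ p (J p.1 (X p.1)) := by
  -- Lifts commute with ξ̄, so zero torsion lets the two arguments be exchanged.
  have h : cov (xiBar β) p (liftField β α ω₁ X p) - cov (liftField β α ω₁ X) p (xiBar β p) =
      mlieBracket (prodModel n) (liftField β α ω₁ X) (xiBar β) p :=
    cov.torsion_eq_zero_iff.1 hcov.torsion_eq_zero
      ((isSmoothField_horizontalLift (β := β) (α := α) hω₁ hX).mdifferentiableAt p)
      (isSmoothField_xiBar.mdifferentiableAt p)
  rw [mlieBracket_liftField_xiBar hω₁ hX, sub_eq_zero] at h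
  rw [← h, cov_xiBar_liftField hJ hω₁ hdω₁ hcov hX]

/-- `∇_{ξ̄} ξ̄ = 0`. -/
lemma cov_xiBar_xiBar [T2Space M₁] (hJ : IsAlmostHermitian J g₁) (hω₁ : IsSmoothOneForm ω₁)
    (hcov : IsLeviCivita (gBar β α g₁ ω₁) cov) (p : M₁ × β.Trace) :
    cov (xiBar β) p (xiBar β p) = 0 := by
  have hg := isRiemannianMetric_gBar (β := β) (α := α) hJ.metric hω₁
  have hξ := (isSmoothField_xiBar (n := n) (M₁ := M₁) (β := β)).mdifferentiableAt p
  refine tangent_ext_gBar (α := α) (ω₁ := ω₁) hJ.metric (fun Z hZ ↦ ?_) ?_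
  · have lZ := (isSmoothField_horizontalLift (β := β) (α := α) hω₁ hZ).mdifferentiableAt p
    have h1 := hcov.two_mul_apply_eq_koszul hg hξ hξ lZ
    simp only [koszul, mlieBracket_xiBar_liftField hω₁ hZ, mlieBracket_self,
      hg.symm _ (xiBar β _) (liftField β α ω₁ _ _), gBar_xiBar_right, etaBar_xiBar,
      etaBar_horizontalLift, mvfderiv_const, map_zero, zero_apply, Pi.zero_apply] at h1
    rw [map_zero, zero_apply]
    linarith
  · have h1 := hcov.two_mul_apply_eq_koszul hg hξ hξ hξ
    simp only [koszul, mlieBracket_self, gBar_xiBar_right, etaBar_xiBar, mvfderiv_const,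
      map_zero, zero_apply, Pi.zero_apply] at h1
    rw [gBar_xiBar_right, map_zero, zero_apply]
    linarith

end Connection

/-! ### Tensoriality of the derivative of an endomorphism field -/

section Parallel

variable {E : Type*} [NormedAddCommGroup E] [NormedSpace ℝ E]
  {H : Type*} [TopologicalSpace H] {I : ModelWithCorners ℝ E H}
  {M : Type*} [TopologicalSpace M] [ChartedSpace H M] [IsManifold I ∞ M]
  {φ : Π x : M, TangentSpace I x →L[ℝ] TangentSpace I x}

lemma IsSmoothEndField.fieldDiffAt_apply (hφ : IsSmoothEndField φ) {Y : Π x : M, TangentSpace I x}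
    {x : M} (hY : FieldDiffAt Y x) : FieldDiffAt (fun y ↦ φ y (Y y)) x :=
  MDifferentiableAt.clm_bundle_apply (F₁ := E) (F₂ := E) (b := fun y : M ↦ y)
    ((hφ x).mdifferentiableAt (by simp)) hY

lemma IsSmoothEndField.isSmoothField_apply (hφ : IsSmoothEndField φ)
    {Y : Π x : M, TangentSpace I x} (hY : IsSmoothField Y) : IsSmoothField (fun y ↦ φ y (Y y)) :=
  fun x ↦ ContMDiffAt.clm_bundle_apply (F₁ := E) (F₂ := E) (b := fun y : M ↦ y) (hφ x) (hY x)

/-- The Leibniz terms X(f) φY of ∇_X(φ(fY)) and of φ(∇_X(fY)) cancel. -/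
lemma tensorialAt_covEnd (cov : CovariantDerivative I E (TangentSpace I : M → Type _))
    (hφ : IsSmoothEndField φ) (X : Π x : M, TangentSpace I x) (x : M) :
    TensorialAt I E (fun Y ↦ covEnd cov φ X Y x) x where
  smul {f Y} hf hY := by
    have h : (fun y ↦ φ y ((f • Y) y)) = f • fun y ↦ φ y (Y y) := by
      ext1 y
      exact map_smul (φ y) (f y) (Y y)
    simp only [covEnd]
    rw [h, cov.isCovariantDerivativeOnUniv.leibniz (hφ.fieldDiffAt_apply hY) hf,
      cov.isCovariantDerivativeOnUniv.leibniz hY hf]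
    simp only [add_apply, smul_apply, ContinuousLinearMap.smulRight_apply, map_add, map_smul]
    module
  add {Y Y'} hY hY' := by
    have h : (fun y ↦ φ y ((Y + Y') y)) = (fun y ↦ φ y (Y y)) + fun y ↦ φ y (Y' y) := by
      ext1 y
      exact map_add (φ y) (Y y) (Y' y)
    simp only [covEnd]
    rw [h, cov.isCovariantDerivativeOnUniv.add (hφ.fieldDiffAt_apply hY) (hφ.fieldDiffAt_apply hY'),
      cov.isCovariantDerivativeOnUniv.add hY hY']
    simp only [add_apply, map_add]
    abel

end Parallel

/-! ### The identity for the derivative of φ̄ -/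

section Main

variable {n m : ℕ} {M₁ : Type*} [TopologicalSpace M₁]
  [ChartedSpace (EuclideanSpace ℝ (Fin (2 * n))) M₁] [IsManifold (𝓡 (2 * n)) ∞ M₁]
  {β : OpenCurve m} {α : ℝ}
  {J : Π x : M₁, TangentSpace (𝓡 (2 * n)) x →L[ℝ] TangentSpace (𝓡 (2 * n)) x}
  {g₁ : Π x : M₁, TangentSpace (𝓡 (2 * n)) x →L[ℝ] TangentSpace (𝓡 (2 * n)) x →L[ℝ] ℝ}
  {ω₁ : Π x : M₁, TangentSpace (𝓡 (2 * n)) x →L[ℝ] ℝ}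
  {cov : CovariantDerivative (prodModel n) (EuclideanSpace ℝ (Fin (2 * n)) × ℝ)
    (TangentSpace (prodModel n) : M₁ × β.Trace → Type _)}

/-- Since J is parallel the horizontal parts cancel, and -α g₁(X₁, J²Y₁) ξ̄ = α g₁(X₁, Y₁) ξ̄
remains. The direction ξ̄ contributes nothing, because -α (J²Y₁)^h arises from both terms. -/
lemma covEnd_phiBar_liftField [T2Space M₁] (hJ : IsAlmostHermitian J g₁)
    (hω₁ : IsSmoothOneForm ω₁)
    (hdω₁ : ∀ X Y : Π x : M₁, TangentSpace (𝓡 (2 * n)) x, IsSmoothField X → IsSmoothField Y →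
      ∀ x : M₁, dOneForm ω₁ X Y x = g₁ x (X x) (J x (Y x)))
    (hcov : IsLeviCivita (gBar β α g₁ ω₁) cov)
    {cov₁ : CovariantDerivative (𝓡 (2 * n)) (EuclideanSpace ℝ (Fin (2 * n)))
      (TangentSpace (𝓡 (2 * n)) : M₁ → Type _)} (hcov₁ : IsLeviCivita g₁ cov₁)
    {X₁ Y₁ : Π x : M₁, TangentSpace (𝓡 (2 * n)) x} (hX₁ : IsSmoothField X₁)
    (hY₁ : IsSmoothField Y₁) {p : M₁ × β.Trace} (hpar : covEnd cov₁ J X₁ Y₁ p.1 = 0)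
    {X : Π q : M₁ × β.Trace, TangentSpace (prodModel n) q} {c : ℝ}
    (hX : X p = liftField β α ω₁ X₁ p + c • xiBar β p) :
    covEnd cov (phiBar β α J ω₁) X (liftField β α ω₁ Y₁) p =
      (α * g₁ p.1 (X₁ p.1) (Y₁ p.1)) • xiBar β p := by
  have hJY₁ := hJ.smooth.isSmoothField_apply hY₁
  rw [covEnd, phiBar_liftField, hX]
  simp only [map_add, map_smul]
  rw [cov_liftField_liftField hJ hω₁ hdω₁ hcov hcov₁ hX₁ hJY₁,
    cov_liftField_liftField hJ hω₁ hdω₁ hcov hcov₁ hX₁ hY₁,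
    cov_liftField_xiBar hJ hω₁ hdω₁ hcov hJY₁, cov_liftField_xiBar hJ hω₁ hdω₁ hcov hY₁]
  have hpar' : cov₁ (fun x ↦ J x (Y₁ x)) p.1 (X₁ p.1) = J p.1 (cov₁ Y₁ p.1 (X₁ p.1)) :=
    sub_eq_zero.1 hpar
  rw [hpar']
  apply tangent_ext (α := α) (ω₁ := ω₁)
  · simp
  · simp [hJ.sq]

/-- As φ̄ξ̄ = 0, what is left is -φ̄(∇_X ξ̄) = α (J²X₁)^h. -/
lemma covEnd_phiBar_xiBar [T2Space M₁] (hJ : IsAlmostHermitian J g₁) (hω₁ : IsSmoothOneForm ω₁)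
    (hdω₁ : ∀ X Y : Π x : M₁, TangentSpace (𝓡 (2 * n)) x, IsSmoothField X → IsSmoothField Y →
      ∀ x : M₁, dOneForm ω₁ X Y x = g₁ x (X x) (J x (Y x)))
    (hcov : IsLeviCivita (gBar β α g₁ ω₁) cov)
    {X₁ : Π x : M₁, TangentSpace (𝓡 (2 * n)) x} (hX₁ : IsSmoothField X₁) {p : M₁ × β.Trace}
    {X : Π q : M₁ × β.Trace, TangentSpace (prodModel n) q} {c : ℝ}
    (hX : X p = liftField β α ω₁ X₁ p + c • xiBar β p) :
    covEnd cov (phiBar β α J ω₁) X (xiBar β) p = (-α) • liftField β α ω₁ X₁ p := by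
  have h0 : (fun q : M₁ × β.Trace ↦ phiBar β α J ω₁ q (xiBar β q)) = 0 := funext phiBar_xiBar
  rw [covEnd, h0, cov.zero, hX]
  simp only [map_add, map_smul]
  rw [cov_xiBar_liftField hJ hω₁ hdω₁ hcov hX₁, cov_xiBar_xiBar hJ hω₁ hcov]
  apply tangent_ext (α := α) (ω₁ := ω₁)
  · simp [hJ.sq]
  · simp

/-- `(∇_X φ̄) Y = α (g(X, Y) ξ̄ - η̄(Y) X)`. -/
lemma covEnd_phiBar [T2Space M₁] (hK : IsKaehler J g₁) (hω₁ : IsSmoothOneForm ω₁)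
    (hdω₁ : ∀ X Y : Π x : M₁, TangentSpace (𝓡 (2 * n)) x, IsSmoothField X → IsSmoothField Y →
      ∀ x : M₁, dOneForm ω₁ X Y x = g₁ x (X x) (J x (Y x)))
    (hcov : IsLeviCivita (gBar β α g₁ ω₁) cov)
    (X : Π q : M₁ × β.Trace, TangentSpace (prodModel n) q)
    {Y : Π q : M₁ × β.Trace, TangentSpace (prodModel n) q} (hY : IsSmoothField Y)
    (p : M₁ × β.Trace) :
    covEnd cov (phiBar β α J ω₁) X Y p =
      α • (gBar β α g₁ ω₁ p (X p) (Y p) • xiBar β p - etaBar β α ω₁ p (Y p) • X p) := by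
  have hJ := hK.almostHermitian
  obtain ⟨cov₁, hcov₁, hpar⟩ := hK.parallel
  obtain ⟨X₁, hX₁, hX₁p⟩ := exists_isSmoothField_apply_eq p.1 (tangentFst β p (X p))
  obtain ⟨Y₁, hY₁, hY₁p⟩ := exists_isSmoothField_apply_eq p.1 (tangentFst β p (Y p))
  have hXp : X p = liftField β α ω₁ X₁ p + etaBar β α ω₁ p (X p) • xiBar β p := by
    rw [liftField, hX₁p, horizontalLift_add_etaBar_smul]
  -- By tensoriality Y may be replaced by any field with the same value at p; freezing its
  -- η̄-coefficient at p makes W a lift plus a constant multiple of ξ̄.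
  let W : Π q : M₁ × β.Trace, TangentSpace (prodModel n) q := liftField β α ω₁ Y₁ +
    (fun _ ↦ etaBar β α ω₁ p (Y p) : M₁ × β.Trace → ℝ) • (xiBar β)
  have hYp : Y p = W p := by
    change Y p = horizontalLift β α ω₁ p (Y₁ p.1) + etaBar β α ω₁ p (Y p) • xiBar β p
    rw [hY₁p, horizontalLift_add_etaBar_smul]
  have hT := tensorialAt_covEnd cov (isSmoothEndField_phiBar (β := β) (α := α) hJ.smooth hω₁) X p
  have lY := (isSmoothField_horizontalLift (β := β) (α := α) hω₁ hY₁).mdifferentiableAt p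
  have hξ := (isSmoothField_xiBar (n := n) (M₁ := M₁) (β := β)).mdifferentiableAt p
  have hc : MDifferentiableAt (prodModel n) 𝓘(ℝ, ℝ)
      (fun _ : M₁ × β.Trace ↦ etaBar β α ω₁ p (Y p)) p := mdifferentiableAt_const
  have hcξ := hc.smul_section hξ
  rw [hT.pointwise (hY.mdifferentiableAt p) (mdifferentiableAt_add_section lY hcξ) hYp,
    hT.add lY hcξ, hT.smul hc hξ,
    covEnd_phiBar_liftField hJ hω₁ hdω₁ hcov hcov₁ hX₁ hY₁ (hpar X₁ Y₁ hX₁ hY₁ p.1) hXp,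
    covEnd_phiBar_xiBar hJ hω₁ hdω₁ hcov hX₁ hXp, gBar_apply, hX₁p, hY₁p, liftField, hX₁p]
  apply tangent_ext (α := α) (ω₁ := ω₁)
  · simp
    module
  · simp only [map_add, map_smul, map_sub, etaBar_xiBar, etaBar_horizontalLift, smul_eq_mul]
    ring

end Main

end

theorem theorem3p4
    {n m : ℕ} (hn : 0 < n)
    {M₁ : Type*} [TopologicalSpace M₁] [ChartedSpace (EuclideanSpace ℝ (Fin (2 * n))) M₁]
    [IsManifold (𝓡 (2 * n)) ∞ M₁] [T2Space M₁] [Nonempty M₁]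
    (J : Π x : M₁, TangentSpace (𝓡 (2 * n)) x →L[ℝ] TangentSpace (𝓡 (2 * n)) x)
    (g₁ : Π x : M₁, TangentSpace (𝓡 (2 * n)) x →L[ℝ] TangentSpace (𝓡 (2 * n)) x →L[ℝ] ℝ)
    (hK : IsKaehler J g₁)
    (ω₁ : Π x : M₁, TangentSpace (𝓡 (2 * n)) x →L[ℝ] ℝ)
    (hω₁ : IsSmoothOneForm ω₁)
    (hdω₁ : ∀ X Y : Π x : M₁, TangentSpace (𝓡 (2 * n)) x, IsSmoothField X → IsSmoothField Y →
      ∀ x : M₁, dOneForm ω₁ X Y x = g₁ x (X x) (J x (Y x)))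
    (β : OpenCurve m) (α : ℝ) :
    IsAlmostContactMetric (M := M₁ × β.Trace)
      (phiBar β α J ω₁) (xiBar β) (etaBar β α ω₁) (gBar β α g₁ ω₁) ∧
    ((∃ cov : CovariantDerivative (prodModel n) (EuclideanSpace ℝ (Fin (2 * n)) × ℝ)
        (TangentSpace (prodModel n) : M₁ × β.Trace → Type _),
        IsLeviCivita (gBar β α g₁ ω₁) cov) ∧
      ∀ cov : CovariantDerivative (prodModel n) (EuclideanSpace ℝ (Fin (2 * n)) × ℝ)
        (TangentSpace (prodModel n) : M₁ × β.Trace → Type _),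
        IsLeviCivita (gBar β α g₁ ω₁) cov →
        ∀ X Y : Π p : M₁ × β.Trace, TangentSpace (prodModel n) p,
          IsSmoothField X → IsSmoothField Y → ∀ p : M₁ × β.Trace,
            covEnd cov (phiBar β α J ω₁) X Y p =
              α • (gBar β α g₁ ω₁ p (X p) (Y p) • xiBar β p - etaBar β α ω₁ p (Y p) • X p)) ∧
    (α ≠ 0 → IsAlphaSasakian (M := M₁ × β.Trace) α
      (phiBar β α J ω₁) (xiBar β) (etaBar β α ω₁) (gBar β α g₁ ω₁)) ∧
    (IsSasakian (M := M₁ × β.Trace)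
      (phiBar β α J ω₁) (xiBar β) (etaBar β α ω₁) (gBar β α g₁ ω₁) ↔ α = 1) := by
  have hAC : IsAlmostContactMetric (M := M₁ × β.Trace)
      (phiBar β α J ω₁) (xiBar β) (etaBar β α ω₁) (gBar β α g₁ ω₁) :=
    isAlmostContactMetric_product hK.almostHermitian hω₁
  obtain ⟨cov, hcov⟩ := hAC.metric.exists_isLeviCivita
  refine ⟨hAC, ⟨⟨cov, hcov⟩, fun cov' hcov' X Y _ hY p ↦ covEnd_phiBar hK hω₁ hdω₁ hcov' X hY p⟩,
    fun hα ↦ ⟨hα, hAC, cov, hcov, fun X Y _ hY p ↦ covEnd_phiBar hK hω₁ hdω₁ hcov X hY p⟩,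
    fun h ↦ ?_, fun h ↦ ⟨hAC, cov, hcov, fun X Y _ hY p ↦ ?_⟩⟩
  · obtain ⟨cov', hcov', hS⟩ := h.nabla_phi
    obtain ⟨p⟩ : Nonempty (M₁ × β.Trace) := inferInstance
    -- Positive dimension supplies a non-zero tangent vector, without which α could not be
    -- recovered.
    have : Nonempty (Fin (2 * n)) := ⟨⟨0, by omega⟩⟩
    obtain ⟨v, hv⟩ : ∃ v : TangentSpace (𝓡 (2 * n)) p.1, v ≠ 0 :=
      exists_ne (0 : EuclideanSpace ℝ (Fin (2 * n)))
    obtain ⟨X₁, hX₁, rfl⟩ := exists_isSmoothField_apply_eq p.1 v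
    have h1 := hS _ _ (isSmoothField_horizontalLift (β := β) (α := α) hω₁ hX₁) isSmoothField_xiBar p
    rw [covEnd_phiBar hK hω₁ hdω₁ hcov' _ isSmoothField_xiBar] at h1
    -- Projecting to M₁ kills ξ̄ and leaves α v = v with v ≠ 0.
    have h2 := congrArg (tangentFst β p) h1
    simp only [map_smul, map_sub, etaBar_xiBar, tangentFst_xiBar, tangentFst_horizontalLift,
      smul_zero, zero_sub, one_smul, smul_neg, neg_inj] at h2
    exact smul_left_injective ℝ hv (h2.trans (one_smul ℝ _).symm)
  · subst h
    rw [covEnd_phiBar hK hω₁ hdω₁ hcov X hY, one_smul]
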